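/- Let $P\subset\mathbb R^3$ be a simplicial convex polytope, that is, the convex hull of finitely many points, with nonempty interior, all of whose two-dimensional faces are triangles. Let $v_1,\dots,v_n$ be its vertices and $E$ its set of edges, and write $(\cdot,\cdot)$ for the standard inner product on $\mathbb R^3$. **Dehn's Theorem.** $P$ is infinitesimally rigid. That is, let the vertices be numbered so that $v_1,v_2,v_3$ are the vertices of any chosen triangular face of $P$ (the base triangle), and let vectors $a_1,\dots,a_n\in\mathbb R^3$ satisfy $$(v_i-v_j,\;a_i-a_j)=0\quad\text{for every edge }(v_i,v_j)\in E,\qquad a_1=a_2=a_3=0 .$$ Then $a_i=0$ for all $i\in\{1,\dots,n\}$. **Stronger form.** The same conclusion holds if the edge condition is weakened to the following: for every edge $(v_i,v_j)\in E$, the numbers $(v_i-v_j,a_i)$ and $(v_i-v_j,a_j)$ are both zero, both negative, or both positive. That is, if this sign condition holds and $a_1=a_2=a_3=0$ for the vertices $v_1,v_2,v_3$ of a triangular face, then $a_i=0$ for all $i$. -/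

import Mathlib

/-- Euclidean space `ℝ³`. -/
abbrev E3 : Type := EuclideanSpace ℝ (Fin 3)

/-- A (full-dimensional) convex polytope in `ℝ³`: the convex hull of finitely many points,
with nonempty interior. -/
structure IsConvexPolytope (P : Set E3) : Prop where
  exists_finite : ∃ S : Set E3, S.Finite ∧ P = convexHull ℝ S
  interior_nonempty : (interior P).Nonempty

/-- `F` is a facet of `P`: a two-dimensional face, where a face is a nonempty set of the form
`{x ∈ P | l x is maximal on P}` for a linear functional `l`. -/
def IsFacet (P F : Set E3) : Prop :=
  F.Nonempty ∧ IsExposed ℝ P F ∧ Module.finrank ℝ (vectorSpan ℝ F) = 2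

/-- `F` is a nondegenerate triangle. -/
def IsTriangle (F : Set E3) : Prop :=
  ∃ x y z : E3, AffineIndependent ℝ ![x, y, z] ∧ F = convexHull ℝ {x, y, z}

/-- A simplicial convex polytope in `ℝ³`: every facet is a triangle. -/
structure IsSimplicialPolytope (P : Set E3) : Prop extends IsConvexPolytope P where
  isTriangle_of_isFacet : ∀ F : Set E3, IsFacet P F → IsTriangle F

/-- The vertices of `P`. -/
abbrev Vertex (P : Set E3) : Type := {x : E3 // x ∈ P.extremePoints ℝ}

/-- `(u, v)` is an edge of `P`: the segment joining the distinct vertices `u`, `v` is a face. -/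
def IsEdge (P : Set E3) (u v : Vertex P) : Prop :=
  u ≠ v ∧ IsExposed ℝ P (segment ℝ (u : E3) (v : E3))

/-- `u, v, w` are the three vertices of a triangular face of `P`. -/
def IsTriangularFace (P : Set E3) (u v w : Vertex P) : Prop :=
  AffineIndependent ℝ ![(u : E3), (v : E3), (w : E3)] ∧
    IsFacet P (convexHull ℝ {(u : E3), (v : E3), (w : E3)})

/-- The vectors `a v`, attached to the vertices, define an infinitesimal rigid motion of `P`. -/
def IsInfinitesimalRigidMotion (P : Set E3) (a : Vertex P → E3) : Prop :=
  ∀ u v : Vertex P, IsEdge P u v → inner ℝ ((u : E3) - (v : E3)) (a u - a v) = 0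

/-- `a` is planted with respect to the base vertices `v₁, v₂, v₃`. -/
def IsPlanted {P : Set E3} (v₁ v₂ v₃ : Vertex P) (a : Vertex P → E3) : Prop :=
  a v₁ = 0 ∧ a v₂ = 0 ∧ a v₃ = 0

/-- `P` is infinitesimally rigid: whichever triangular face is taken as base triangle, every
planted infinitesimal rigid motion is trivial. -/
def IsInfinitesimallyRigid (P : Set E3) : Prop :=
  ∀ v₁ v₂ v₃ : Vertex P, IsTriangularFace P v₁ v₂ v₃ →
    ∀ a : Vertex P → E3, IsInfinitesimalRigidMotion P a → IsPlanted v₁ v₂ v₃ a →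
      ∀ v : Vertex P, a v = 0

/-- For every edge of `P`, the projections onto it of the two vectors attached to its ends
have the same sign: both zero, both negative, or both positive. -/
def HasSameSignProjections (P : Set E3) (a : Vertex P → E3) : Prop :=
  ∀ u v : Vertex P, IsEdge P u v →
    (inner ℝ ((u : E3) - (v : E3)) (a u) = 0 ∧ inner ℝ ((u : E3) - (v : E3)) (a v) = 0) ∨
    (inner ℝ ((u : E3) - (v : E3)) (a u) < 0 ∧ inner ℝ ((u : E3) - (v : E3)) (a v) < 0) ∨
    (0 < inner ℝ ((u : E3) - (v : E3)) (a u) ∧ 0 < inner ℝ ((u : E3) - (v : E3)) (a v))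

/-!
# Infinitesimal rigidity of simplicial convex polytopes

Suppose the vectors `a v` satisfy the sign condition, vanish on the base triangle, and do not all
vanish. Call a vertex live if its vector is nonzero, and dead otherwise. The sign condition
orients every edge from both ends consistently, except for the edges without orientation, where
both projections are zero. At a vertex `v` consider the jumps of the sign of `⟪a v, u - v⟫`
between the two edges of a face at `v`, summed over the faces at `v`.

* At a live vertex this total is at most four, because the plane `v + (a v)ᗮ` crosses at most two
  faces at `v`; this remains true if two is added for a face at `v` contained in that plane
  (`card_signChanges_add_le`).
* In a face with a live vertex, the weights so defined add up to at least two over its live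
  vertices (`two_le_weight_triangle`). At dead vertices all edges are without orientation and
  nothing is lost.

Usually one concludes with Euler's formula. Instead, the same count is made here for a second,
explicit system of orientations, given by a pencil of planes: take a point `z` just beyond the
base face (`exists_apex`), and order the vertices by the plane of the pencil through a line at `z`
on which they lie. Infinitesimally, this is a rotation about that line.

* A vertex outside the base face sees `z` through the interior of `P`, so that the plane of the
  pencil through it meets the interior, and the total of the jumps there is at least four
  (`two_le_card_signChanges`).
* In every face the jumps add up to at most two (`sum_sign_jumps_le_two`), because just one of the
  three vertices is in the middle.

Summing over the live vertices, the weights for `a` are at most the jumps for the pencil; summing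
over the faces, they are at least these jumps. If the pencil is chosen such that one of its planes
contains both a live vertex and a dead vertex of some face, the dead vertex takes part of the
jumps in this face, one inequality is strict, and this is a contradiction.

The facts on polytopes needed for this rest on the description of a polytope as an intersection of
half-spaces bounded by facets (`exists_isFacet_separating`). From it follows that a point moving
out of the interior parallel to a supporting plane at a vertex `v` leaves the cone of `P` at `v`
through a face (`exists_face_exit`), which gives the lower bound for the number of sign changes
around `v`.
-/

/-! ### Faces of convex hulls -/

namespace DehnRigidity

/-- The face of a convex hull cut out by a supporting functional is spanned by the generators
lying on it. -/
theorem mem_convexHull_sep_of_eq {S : Set E3} {l : E3 →L[ℝ] ℝ} {m : ℝ} (hS : ∀ s ∈ S, l s ≤ m)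
    {x : E3} (hx : x ∈ convexHull ℝ S) (hlx : l x = m) :
    x ∈ convexHull ℝ {s ∈ S | l s = m} := by
  have hconv : Convex ℝ {x : E3 | l x ≤ m ∧ (l x = m → x ∈ convexHull ℝ {s ∈ S | l s = m})} := by
    rw [convex_iff_forall_pos]
    rintro y ⟨hy, hy'⟩ z ⟨hz, hz'⟩ a b ha hb hab
    have hl : l (a • y + b • z) = a * l y + b * l z := by simp
    have hb' : b = 1 - a := by linarith
    refine ⟨by rw [hl, hb']; rw [hb'] at hb; nlinarith, fun h => ?_⟩
    rw [hl] at h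
    have h1 : a * (m - l y) + b * (m - l z) = 0 := by rw [hb'] at h ⊢; linarith
    have h2 : 0 ≤ a * (m - l y) := mul_nonneg ha.le (by linarith)
    have h3 : 0 ≤ b * (m - l z) := mul_nonneg hb.le (by linarith)
    have h4 : m - l y = 0 := by
      rcases mul_eq_zero.1 (by linarith : a * (m - l y) = 0) with h | h <;> linarith
    have h5 : m - l z = 0 := by
      rcases mul_eq_zero.1 (by linarith : b * (m - l z) = 0) with h | h <;> linarith
    exact convex_convexHull ℝ _ (hy' (by linarith)) (hz' (by linarith)) ha.le hb.le hab
  have : convexHull ℝ S ⊆ {x : E3 | l x ≤ m ∧ (l x = m → x ∈ convexHull ℝ {s ∈ S | l s = m})} :=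
    convexHull_min (fun s hs => ⟨hS s hs, fun h => subset_convexHull ℝ _ ⟨hs, h⟩⟩) hconv
  exact (this hx).2 hlx

theorem le_of_mem_convexHull {S : Set E3} {l : E3 →L[ℝ] ℝ} {m : ℝ} (hS : ∀ s ∈ S, l s ≤ m)
    {x : E3} (hx : x ∈ convexHull ℝ S) : l x ≤ m := by
  have : convexHull ℝ S ⊆ {x : E3 | l x ≤ m} :=
    convexHull_min hS (convex_halfSpace_le l.isLinear m)
  exact this hx

variable {P : Set E3}

theorem _root_.IsConvexPolytope.convex (hP : IsConvexPolytope P) : Convex ℝ P := by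
  obtain ⟨S, -, rfl⟩ := hP.exists_finite
  exact convex_convexHull ℝ S

theorem _root_.IsConvexPolytope.isCompact (hP : IsConvexPolytope P) : IsCompact P := by
  obtain ⟨S, hS, rfl⟩ := hP.exists_finite
  exact hS.isCompact_convexHull ℝ

theorem _root_.IsConvexPolytope.finite_extremePoints (hP : IsConvexPolytope P) :
    (P.extremePoints ℝ).Finite := by
  obtain ⟨S, hS, rfl⟩ := hP.exists_finite
  exact hS.subset extremePoints_convexHull_subset

theorem _root_.IsConvexPolytope.eq_convexHull_extremePoints (hP : IsConvexPolytope P) :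
    P = convexHull ℝ (P.extremePoints ℝ) := by
  have h := closure_convexHull_extremePoints hP.isCompact hP.convex
  rwa [(hP.finite_extremePoints.isClosed_convexHull ℝ).closure_eq, eq_comm] at h

theorem lt_of_mem_interior {l : E3 →L[ℝ] ℝ} (hl : l ≠ 0) {m : ℝ} (h : ∀ x ∈ P, l x ≤ m)
    {q : E3} (hq : q ∈ interior P) : l q < m := by
  obtain ⟨y, hy⟩ : ∃ y, l y ≠ 0 := by
    by_contra! hc
    exact hl (ContinuousLinearMap.ext hc)
  have hcont : Filter.Tendsto (fun t : ℝ => q + t • (l y • y))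
      (nhdsWithin 0 (Set.Ioi 0)) (nhds q) := by
    have : Continuous fun t : ℝ => q + t • (l y • y) := by fun_prop
    simpa using (this.tendsto 0).mono_left nhdsWithin_le_nhds
  obtain ⟨t, ht, ht0⟩ := ((hcont.eventually (mem_interior_iff_mem_nhds.1 hq)).and
    self_mem_nhdsWithin).exists
  have h1 := h _ ht
  have h2 : 0 < t * (l y * l y) := mul_pos ht0 (mul_self_pos.2 hy)
  simp only [map_add, map_smul, smul_eq_mul] at h1
  linarith

theorem exists_support_of_notMem_interior (hP : IsConvexPolytope P) {x : E3}
    (hx : x ∉ interior P) : ∃ f : E3 →L[ℝ] ℝ, f ≠ 0 ∧ ∀ y ∈ P, f y ≤ f x := by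
  obtain ⟨f, hf⟩ := geometric_hahn_banach_open_point hP.convex.interior isOpen_interior hx
  obtain ⟨q, hq⟩ := hP.interior_nonempty
  refine ⟨f, fun h => ?_, fun y hy => ?_⟩
  · have := hf q hq
    simp [h] at this
  · have hcl : y ∈ closure (interior P) := by
      rw [hP.convex.closure_interior_eq_closure_of_nonempty_interior ⟨q, hq⟩]
      exact subset_closure hy
    exact closure_minimal (fun z hz => (hf z hz).le)
      (isClosed_le f.continuous continuous_const) hcl

/-- Every point outside a polytope is separated from it by a facet. The functional is an extreme
point of the polar dual of the polytope, chosen in the face where the evaluation at the given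
point is maximal; extremality forces the generators on which it is tight to span. -/
theorem exists_isFacet_separating (hP : IsConvexPolytope P) {x : E3} (hx : x ∉ P) :
    ∃ (F : Set E3) (l : E3 →L[ℝ] ℝ) (m : ℝ), IsFacet P F ∧ (∀ p ∈ P, l p ≤ m) ∧
      F = {p ∈ P | l p = m} ∧ m < l x := by
  obtain ⟨S, hS, hPS⟩ := hP.exists_finite
  obtain ⟨q, hq⟩ := hP.interior_nonempty
  -- the polar dual of `P` with respect to `q`
  set D : Set E3 := {y | ∀ s ∈ P, inner ℝ y (s - q) ≤ 1} with hD
  have hDS : ∀ y : E3, (∀ s ∈ S, inner ℝ y (s - q) ≤ 1) → y ∈ D := by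
    intro y hy s hs
    have := le_of_mem_convexHull (l := innerSL ℝ y) (m := 1 + inner ℝ y q) (S := S)
      (fun s hs => by have := hy s hs; rw [inner_sub_right] at this; simp; linarith)
      (hPS ▸ hs)
    rw [inner_sub_right]
    simp at this
    linarith
  have hDclosed : IsClosed D := by
    have : D = ⋂ s ∈ P, {y : E3 | inner ℝ y (s - q) ≤ 1} := by ext; simp [hD]
    rw [this]
    exact isClosed_biInter fun s _ =>
      isClosed_le (continuous_id.inner continuous_const) continuous_const
  have hDbdd : Bornology.IsBounded D := by
    obtain ⟨r, hr, hball⟩ := Metric.mem_nhds_iff.1 (mem_interior_iff_mem_nhds.1 hq)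
    refine (Metric.isBounded_closedBall (x := (0 : E3)) (r := 2 / r)).subset fun y hy => ?_
    rw [mem_closedBall_zero_iff]
    by_cases hy0 : y = 0
    · subst hy0; simp; positivity
    have hn : 0 < ‖y‖ := norm_pos_iff.2 hy0
    have hmem : q + (r / 2 / ‖y‖) • y ∈ P := by
      apply hball
      rw [mem_ball_iff_norm, add_sub_cancel_left, norm_smul, Real.norm_of_nonneg (by positivity),
        div_mul_cancel₀ _ hn.ne']
      linarith
    have := hy _ hmem
    rw [add_sub_cancel_left, inner_smul_right, real_inner_self_eq_norm_sq] at this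
    rw [le_div_iff₀ hr]
    have h2 : r / 2 / ‖y‖ * ‖y‖ ^ 2 = r / 2 * ‖y‖ := by field_simp
    rw [h2] at this
    linarith
  have hDcompact : IsCompact D := Metric.isCompact_of_isClosed_isBounded hDclosed hDbdd
  -- a dual point which already separates `x`
  obtain ⟨y₁, hy₁, hy₁x⟩ : ∃ y ∈ D, 1 < inner ℝ y (x - q) := by
    obtain ⟨f, u, hfu, hux⟩ := geometric_hahn_banach_closed_point hP.convex hP.isCompact.isClosed hx
    set y := (InnerProductSpace.toDual ℝ E3).symm f with hy
    have hyf : ∀ z, inner ℝ y z = f z := fun z => InnerProductSpace.toDual_symm_apply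
    have hpos : 0 < u - f q := sub_pos.2 (hfu q (interior_subset hq))
    refine ⟨(u - f q)⁻¹ • y, fun s hs => ?_, ?_⟩
    · rw [real_inner_smul_left, hyf, map_sub, inv_mul_le_iff₀ hpos]
      linarith [hfu s hs]
    · rw [real_inner_smul_left, hyf, map_sub, lt_inv_mul_iff₀ hpos]
      linarith
  -- the dual face where the evaluation at `x` is maximal, and an extreme point of it
  set B := (innerSL ℝ (x - q)).toExposed D with hB
  have hBexp : IsExposed ℝ D B := ContinuousLinearMap.toExposed.isExposed
  have hBne : B.Nonempty := by
    obtain ⟨y, hy, hmax⟩ := hDcompact.exists_isMaxOn ⟨y₁, hy₁⟩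
      (innerSL ℝ (x - q)).continuous.continuousOn
    exact ⟨y, hy, fun z hz => hmax hz⟩
  obtain ⟨y₀, hy₀⟩ := (hBexp.isCompact hDcompact).extremePoints_nonempty hBne
  have hy₀B : y₀ ∈ B := hy₀.1
  have hy₀D : y₀ ∈ D.extremePoints ℝ := hBexp.isExtreme.extremePoints_subset_extremePoints hy₀
  have hy₀x : 1 < inner ℝ y₀ (x - q) := by
    have := hy₀B.2 y₁ hy₁
    simp only [innerSL_apply_apply] at this
    rw [real_inner_comm] at hy₁x ⊢
    linarith
  set A : Set E3 := {s ∈ S | inner ℝ y₀ (s - q) = 1} with hA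
  have hspan : Submodule.span ℝ ((fun s => s - q) '' A) = ⊤ := by
    by_contra hne
    -- otherwise `y₀` could be moved within `D` in both directions orthogonal to the span
    obtain ⟨g, hg, hg0⟩ := Submodule.exists_mem_ne_zero_of_ne_bot
      (fun h => hne ((Submodule.orthogonal_eq_bot_iff).1 h))
    have hgA : ∀ s ∈ A, inner ℝ g (s - q) = 0 := fun s hs => by
      rw [real_inner_comm]
      exact (Submodule.mem_orthogonal _ _).1 hg _ (Submodule.subset_span ⟨s, hs, rfl⟩)
    have hev : ∀ g' : E3, (∀ s ∈ A, inner ℝ g' (s - q) = 0) →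
        ∀ᶠ ε in nhdsWithin (0 : ℝ) (Set.Ioi 0), y₀ + ε • g' ∈ D := by
      intro g' hg'
      have : ∀ s ∈ S, ∀ᶠ ε in nhdsWithin (0 : ℝ) (Set.Ioi 0),
          inner ℝ (y₀ + ε • g') (s - q) ≤ 1 := by
        intro s hs
        rcases (hy₀D.1 s (hPS ▸ subset_convexHull ℝ S hs)).lt_or_eq with hlt | heq
        · have hc : Continuous fun ε : ℝ => inner ℝ (y₀ + ε • g') (s - q) := by fun_prop
          have : Filter.Tendsto (fun ε : ℝ => inner ℝ (y₀ + ε • g') (s - q))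
              (nhdsWithin 0 (Set.Ioi 0)) (nhds (inner ℝ y₀ (s - q))) := by
            simpa using (hc.tendsto 0).mono_left nhdsWithin_le_nhds
          exact (this.eventually (gt_mem_nhds hlt)).mono fun _ h => le_of_lt h
        · refine Filter.Eventually.of_forall fun ε => ?_
          rw [inner_add_left, real_inner_smul_left, hg' s ⟨hs, heq⟩, heq]
          simp
      exact ((Filter.eventually_all_finite hS).2 this).mono fun ε h => hDS _ h
    obtain ⟨ε, ⟨h1, h2⟩, hε⟩ := (((hev g hgA).and (hev (-g) (fun s hs => by
      rw [inner_neg_left, hgA s hs, neg_zero]))).and self_mem_nhdsWithin).exists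
    have hseg : y₀ ∈ openSegment ℝ (y₀ + ε • g) (y₀ + ε • (-g)) :=
      ⟨1 / 2, 1 / 2, by norm_num, by norm_num, by norm_num, by module⟩
    have := hy₀D.2 h1 h2 hseg
    have h3 : ε • g = 0 := by simpa using this
    exact (smul_ne_zero (ne_of_gt hε) hg0) h3
  have hAne : A.Nonempty := by
    rw [Set.nonempty_iff_ne_empty]
    intro h
    rw [h, Set.image_empty, Submodule.span_empty] at hspan
    exact bot_ne_top hspan
  obtain ⟨s₀, hs₀⟩ := hAne
  have hAP : ∀ s ∈ A, s ∈ P := fun s hs => hPS ▸ subset_convexHull ℝ S hs.1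
  have hle : ∀ p ∈ P, innerSL ℝ y₀ p ≤ 1 + inner ℝ y₀ q := fun p hp => by
    have := hy₀D.1 p hp
    rw [inner_sub_right] at this
    simp only [innerSL_apply_apply]
    linarith
  have hAeq : ∀ s ∈ A, innerSL ℝ y₀ s = 1 + inner ℝ y₀ q := fun s hs => by
    have := hs.2
    rw [inner_sub_right] at this
    simp only [innerSL_apply_apply]
    linarith
  refine ⟨{p ∈ P | innerSL ℝ y₀ p = 1 + inner ℝ y₀ q}, innerSL ℝ y₀, 1 + inner ℝ y₀ q,
    ⟨⟨s₀, hAP _ hs₀, hAeq _ hs₀⟩, fun _ => ⟨innerSL ℝ y₀, ?_⟩, ?_⟩, hle, rfl, ?_⟩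
  · ext p
    refine ⟨fun h => ⟨h.1, fun y hy => h.2 ▸ hle y hy⟩, fun h => ⟨h.1, le_antisymm (hle p h.1) ?_⟩⟩
    exact hAeq _ hs₀ ▸ h.2 _ (hAP _ hs₀)
  · set F := {p ∈ P | innerSL ℝ y₀ p = 1 + inner ℝ y₀ q}
    have hAF : ∀ s ∈ A, s ∈ F := fun s hs => ⟨hAP s hs, hAeq s hs⟩
    have h0 : y₀ ≠ 0 := by
      rintro rfl
      simp at hy₀x
      linarith
    have hlt : vectorSpan ℝ F < ⊤ := by
      refine lt_top_iff_ne_top.2 fun htop => h0 ?_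
      have hsub : vectorSpan ℝ F ≤ (innerSL ℝ y₀).toLinearMap.ker := by
        rw [vectorSpan, Submodule.span_le]
        rintro _ ⟨a, ha, b, hb, rfl⟩
        simp only [SetLike.mem_coe, LinearMap.mem_ker, vsub_eq_sub, ContinuousLinearMap.coe_coe]
        rw [map_sub, ha.2, hb.2, sub_self]
      rw [htop] at hsub
      have : innerSL ℝ y₀ y₀ = 0 := hsub (Submodule.mem_top (x := y₀))
      simpa using this
    have hsup : Submodule.span ℝ {s₀ - q} ⊔ vectorSpan ℝ F = ⊤ := by
      rw [eq_top_iff, ← hspan, Submodule.span_le]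
      rintro _ ⟨s, hs, rfl⟩
      have : s - q = (s₀ - q) + (s - s₀) := by abel
      simp only [this]
      exact Submodule.add_mem_sup (Submodule.mem_span_singleton_self _)
        (vsub_mem_vectorSpan ℝ (hAF s hs) (hAF s₀ hs₀))
    have h3 : Module.finrank ℝ E3 = 3 := by simp
    have h1 := Submodule.finrank_lt hlt.ne
    have h2 := Submodule.finrank_add_le_finrank_add_finrank (Submodule.span ℝ {s₀ - q})
      (vectorSpan ℝ F)
    rw [hsup, finrank_top] at h2
    have h4 := finrank_span_le_card (R := ℝ) ({s₀ - q} : Set E3)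
    simp at h4
    omega
  · rw [inner_sub_right] at hy₀x
    simp only [innerSL_apply_apply]
    linarith

/-! ### Triangular faces and edges of a simplicial polytope -/

theorem _root_.IsTriangularFace.swap_right {u v w : Vertex P} (h : IsTriangularFace P u v w) :
    IsTriangularFace P u w v := by
  refine ⟨?_, by rw [Set.pair_comm]; exact h.2⟩
  rw [affineIndependent_iff_linearIndependent_vsub ℝ _ (0 : Fin 3)]
  have := h.1.comp_embedding (Equiv.swap (1 : Fin 3) 2).toEmbedding
  convert (affineIndependent_iff_linearIndependent_vsub ℝ _ (0 : Fin 3)).1 this using 1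
  have h2 : ![(u : E3), w, v] = ![(u : E3), v, w] ∘ (Equiv.swap (1 : Fin 3) 2).toEmbedding := by
    funext i; fin_cases i <;> rfl
  rw [h2]

theorem _root_.IsTriangularFace.swap_left {u v w : Vertex P} (h : IsTriangularFace P u v w) :
    IsTriangularFace P v u w := by
  refine ⟨?_, by rw [Set.insert_comm]; exact h.2⟩
  have := h.1.comp_embedding (Equiv.swap (0 : Fin 3) 1).toEmbedding
  convert this using 1
  funext i; fin_cases i <;> rfl

theorem _root_.IsTriangularFace.rotate {u v w : Vertex P} (h : IsTriangularFace P u v w) :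
    IsTriangularFace P v w u := h.swap_left.swap_right

theorem isTriangularFace_swap_right {u v w : Vertex P} :
    IsTriangularFace P u v w ↔ IsTriangularFace P u w v :=
  ⟨fun h => h.swap_right, fun h => h.swap_right⟩

theorem _root_.IsTriangularFace.linearIndependent {u v w : Vertex P}
    (h : IsTriangularFace P u v w) :
    LinearIndependent ℝ ![(v : E3) - u, (w : E3) - u] := by
  have := (affineIndependent_iff_linearIndependent_vsub ℝ _ (0 : Fin 3)).1 h.1
  have h2 := this.comp (fun i : Fin 2 => (⟨i.succ, Fin.succ_ne_zero i⟩ : {x : Fin 3 // x ≠ 0}))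
    (fun i j hij => by simpa using hij)
  have h3 : ![(v : E3) - u, (w : E3) - u] =
      (fun i : {x : Fin 3 // x ≠ 0} => (![(u : E3), v, w] i -ᵥ ![(u : E3), v, w] 0 : E3)) ∘
        fun i : Fin 2 => ⟨i.succ, Fin.succ_ne_zero i⟩ := by
    funext i; fin_cases i <;> simp
  rw [h3]
  exact h2

theorem _root_.IsTriangularFace.ne {u v w : Vertex P} (h : IsTriangularFace P u v w) : v ≠ w := by
  rintro rfl
  have := h.linearIndependent.injective (a₁ := 0) (a₂ := 1) rfl
  simp at this

/-- `l` is an outer normal functional of the triangular face `u v w` of `P`: it is maximal over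
`P` exactly on that face. -/
structure IsFaceNormal (P : Set E3) (l : E3 →L[ℝ] ℝ) (u v w : Vertex P) : Prop where
  eq₁ : l v = l u
  eq₂ : l w = l u
  le : ∀ x ∈ P, l x ≤ l u
  mem : ∀ x ∈ P, l x = l u → x ∈ convexHull ℝ {(u : E3), (v : E3), (w : E3)}
  ne_zero : l ≠ 0

namespace IsFaceNormal

variable {l : E3 →L[ℝ] ℝ} {u v w : Vertex P}

theorem swap_right (h : IsFaceNormal P l u v w) : IsFaceNormal P l u w v :=
  ⟨h.eq₂, h.eq₁, h.le, fun x hx hl => by rw [Set.pair_comm]; exact h.mem x hx hl, h.ne_zero⟩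

theorem swap_left (h : IsFaceNormal P l u v w) : IsFaceNormal P l v u w :=
  ⟨h.eq₁.symm, h.eq₂.trans h.eq₁.symm, fun x hx => (h.le x hx).trans h.eq₁.ge,
    fun x hx hl => by rw [Set.insert_comm]; exact h.mem x hx (hl.trans h.eq₁), h.ne_zero⟩

theorem eq_of_apply_eq (hP : Convex ℝ P) (h : IsFaceNormal P l u v w) {x : Vertex P}
    (hx : l x = l u) :
    x = u ∨ x = v ∨ x = w := by
  have h1 := h.mem x x.2.1 hx
  by_contra! hc
  have hsub : convexHull ℝ {(u : E3), (v : E3), (w : E3)} ⊆ P := by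
    refine convexHull_min ?_ hP
    rintro y (rfl | rfl | rfl)
    exacts [u.2.1, v.2.1, w.2.1]
  rcases extremePoints_convexHull_subset
    (inter_extremePoints_subset_extremePoints_of_subset hsub ⟨h1, x.2⟩) with h | h | h
  · exact hc.1 (Subtype.ext h)
  · exact hc.2.1 (Subtype.ext h)
  · exact hc.2.2 (Subtype.ext h)

end IsFaceNormal

theorem _root_.IsTriangularFace.exists_isFaceNormal (hP : IsConvexPolytope P) {u v w : Vertex P}
    (h : IsTriangularFace P u v w) : ∃ l, IsFaceNormal P l u v w := by
  obtain ⟨-, hne, hexp, hrank⟩ := h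
  obtain ⟨l, hl⟩ := hexp hne
  have hmem : ∀ y : Vertex P, (y : E3) ∈ ({(u : E3), (v : E3), (w : E3)} : Set E3) →
      ∀ x ∈ P, l x ≤ l y := fun y hy => by
    have := subset_convexHull ℝ _ hy
    rw [hl] at this
    exact this.2
  have hu := hmem u (by simp)
  have hv := hmem v (by simp)
  have hw := hmem w (by simp)
  refine ⟨l, le_antisymm (hu v v.2.1) (hv u u.2.1), le_antisymm (hu w w.2.1) (hw u u.2.1), hu,
    fun x hx hlx => ?_, ?_⟩
  · rw [hl]
    exact ⟨hx, fun y hy => hlx ▸ hu y hy⟩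
  · rintro rfl
    have hPF : convexHull ℝ {(u : E3), (v : E3), (w : E3)} = P := by rw [hl]; simp
    rw [hPF] at hrank
    have h1 := (hP.convex.interior_nonempty_iff_affineSpan_eq_top).1 hP.interior_nonempty
    rw [← direction_affineSpan, h1, AffineSubspace.direction_top, finrank_top] at hrank
    simp at hrank

theorem mem_extremePoints_convexHull_of_not_collinear {a b c : E3}
    (h : ¬Collinear ℝ {a, b, c}) : a ∈ (convexHull ℝ {a, b, c}).extremePoints ℝ := by
  by_contra ha
  have hsub : (convexHull ℝ {a, b, c}).extremePoints ℝ ⊆ {b, c} := fun y hy =>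
    (extremePoints_convexHull_subset hy).resolve_left fun h => ha (h ▸ hy)
  have hcpt : IsCompact (convexHull ℝ {a, b, c}) := (Set.toFinite _).isCompact_convexHull ℝ
  have hmem : a ∈ convexHull ℝ {b, c} := by
    have := closure_convexHull_extremePoints hcpt (convex_convexHull ℝ _)
    rw [(((Set.toFinite {b, c}).subset hsub).isClosed_convexHull ℝ).closure_eq] at this
    have ha' : a ∈ convexHull ℝ {a, b, c} := subset_convexHull ℝ _ (by simp)
    rw [← this] at ha'
    exact convexHull_mono hsub ha'
  exact h ((collinear_insert_iff_of_mem_affineSpan (convexHull_subset_affineSpan _ hmem)).2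
    (collinear_pair ℝ b c))

/-- A simplicial polytope is the intersection of the half-spaces of its triangular faces. -/
theorem exists_isTriangularFace_separating (hP : IsSimplicialPolytope P) {x : E3} (hx : x ∉ P) :
    ∃ (u v w : Vertex P), IsTriangularFace P u v w ∧ ∃ l, IsFaceNormal P l u v w ∧ l u < l x := by
  obtain ⟨F, l, m, hF, hle, hFl, hlt⟩ := exists_isFacet_separating hP.toIsConvexPolytope hx
  obtain ⟨a, b, c, hind, hconv⟩ := hP.isTriangle_of_isFacet F hF
  have hmem : ∀ y ∈ ({a, b, c} : Set E3), y ∈ F := fun y hy => hconv ▸ subset_convexHull ℝ _ hy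
  have hext : ∀ y ∈ ({a, b, c} : Set E3), y ∈ P.extremePoints ℝ := by
    have hFP : IsExposed ℝ P F := hF.2.1
    have hsub := hFP.isExtreme.extremePoints_subset_extremePoints
    have hcol := affineIndependent_iff_not_collinear_set.1 hind
    rintro y (rfl | rfl | rfl) <;> apply hsub <;> rw [hconv]
    · exact mem_extremePoints_convexHull_of_not_collinear hcol
    · rw [Set.insert_comm] at hcol ⊢
      exact mem_extremePoints_convexHull_of_not_collinear hcol
    · rw [Set.pair_comm, Set.insert_comm] at hcol ⊢
      exact mem_extremePoints_convexHull_of_not_collinear hcol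
  have hlm : ∀ y ∈ ({a, b, c} : Set E3), l y = m := fun y hy => (hFl ▸ hmem y hy).2
  have ha := hlm a (by simp)
  have hb := hlm b (by simp)
  have hc := hlm c (by simp)
  refine ⟨⟨a, hext a (by simp)⟩, ⟨b, hext b (by simp)⟩, ⟨c, hext c (by simp)⟩,
    ⟨hind, hconv ▸ hF⟩, l, ⟨hb.trans ha.symm, hc.trans ha.symm, fun x hx => ha ▸ hle x hx,
    fun x hx hlx => ?_, ?_⟩, ha ▸ hlt⟩
  · rw [← hconv, hFl]
    exact ⟨hx, hlx.trans ha⟩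
  · rintro rfl
    simp at ha hlt
    linarith

/-- A functional vanishing on the plane of a face is a multiple of its normal. -/
theorem IsFaceNormal.exists_eq_smul {l : E3 →L[ℝ] ℝ} {u v w : Vertex P}
    (h : IsFaceNormal P l u v w) (hF : IsTriangularFace P u v w) {f : E3 →L[ℝ] ℝ}
    (hv : f (v - u) = 0) (hw : f (w - u) = 0) : ∃ κ : ℝ, f = κ • l := by
  obtain ⟨y, hy⟩ : ∃ y, l y ≠ 0 := by
    by_contra! hc
    exact h.ne_zero (ContinuousLinearMap.ext hc)
  have hsub : ∀ g : E3 →L[ℝ] ℝ, g (v - u) = 0 → g (w - u) = 0 →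
      Submodule.span ℝ (Set.range ![(v : E3) - u, (w : E3) - u]) ≤ g.toLinearMap.ker := by
    intro g h1 h2
    rw [Submodule.span_le]
    rintro _ ⟨i, rfl⟩
    fin_cases i
    exacts [h1, h2]
  have hker : Submodule.span ℝ (Set.range ![(v : E3) - u, (w : E3) - u]) = l.toLinearMap.ker := by
    refine Submodule.eq_of_le_of_finrank_le (hsub l (by rw [map_sub, h.eq₁, sub_self])
      (by rw [map_sub, h.eq₂, sub_self])) ?_
    rw [finrank_span_eq_card hF.linearIndependent]
    have hlt : l.toLinearMap.ker < ⊤ := lt_top_iff_ne_top.2 fun htop => hy <| by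
      have : y ∈ l.toLinearMap.ker := htop ▸ Submodule.mem_top
      exact this
    have := Submodule.finrank_lt hlt.ne
    simp at this ⊢
    omega
  refine ⟨f y / l y, ContinuousLinearMap.ext fun x => ?_⟩
  have hx : x - (l x / l y) • y ∈ l.toLinearMap.ker := by
    simp [hy]
  have := hsub f hv hw (hker ▸ hx)
  simp only [LinearMap.mem_ker, ContinuousLinearMap.coe_coe, map_sub, map_smul, smul_eq_mul] at this
  simp only [smul_apply, smul_eq_mul]
  field_simp at this ⊢
  linarith

theorem exists_nonneg_of_mem_convexHull {u v w x : E3} (hx : x ∈ convexHull ℝ {u, v, w}) :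
    ∃ α β : ℝ, 0 ≤ α ∧ 0 ≤ β ∧ x - u = α • (v - u) + β • (w - u) := by
  rw [convexHull_insert (by simp), convexHull_pair, mem_convexJoin] at hx
  obtain ⟨_, rfl, y, ⟨a, b, ha, hb, hab, rfl⟩, c, d, hc, hd, hcd, rfl⟩ := hx
  refine ⟨d * a, d * b, by positivity, by positivity, ?_⟩
  obtain rfl : a = 1 - b := by linarith
  obtain rfl : c = 1 - d := by linarith
  module

/-- A side of a face is exposed in `P`: a large multiple of the normal of the face, which confines
the maximum to the face, is added to a functional exposing the side within the face. -/
theorem _root_.IsTriangularFace.isEdge (hP : IsConvexPolytope P) {u v w : Vertex P}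
    (h : IsTriangularFace P u v w) : IsEdge P u v := by
  refine ⟨h.rotate.rotate.ne, fun _ => ?_⟩
  obtain ⟨l, hl⟩ := h.exists_isFaceNormal hP
  -- a functional constant on the edge and smaller at the third vertex of the face
  obtain ⟨g, hgv, hgw⟩ : ∃ g : E3 →L[ℝ] ℝ, g v = g u ∧ g w < g u := by
    set D : E3 := v - u
    set W : E3 := w - u
    -- a multiple of the component of `W` orthogonal to `D`
    set r : E3 := (inner ℝ D D : ℝ) • W - (inner ℝ D W : ℝ) • D with hr
    have hDr : inner ℝ D r = 0 := by
      rw [hr, inner_sub_right, inner_smul_right, inner_smul_right]; ring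
    have hli := LinearIndependent.pair_iff.1 h.linearIndependent
    have hD : 0 < inner ℝ D D := by
      refine real_inner_self_pos.2 fun h0 => ?_
      have := (hli 1 0 (by rw [zero_smul, one_smul, add_zero]; exact h0)).1
      norm_num at this
    have hr0 : r ≠ 0 := fun h0 => by
      have := (hli (-(inner ℝ D W)) (inner ℝ D D) (by rw [← h0, hr]; module)).2
      linarith
    have hrr : inner ℝ r r = inner ℝ D D * inner ℝ W r := by
      conv_lhs => rw [hr, inner_sub_left, real_inner_smul_left, real_inner_smul_left, ← hr, hDr]
      ring
    have hWr : 0 < inner ℝ W r := by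
      have := real_inner_self_pos.2 hr0
      rw [hrr] at this
      exact pos_of_mul_pos_right this hD.le
    refine ⟨-innerSL ℝ r, ?_, ?_⟩
    · have : inner ℝ r (v : E3) - inner ℝ r (u : E3) = 0 := by
        rw [← inner_sub_right, real_inner_comm]; exact hDr
      simp; linarith
    · have : inner ℝ r (w : E3) - inner ℝ r (u : E3) > 0 := by
        rw [← inner_sub_right, real_inner_comm]; exact hWr
      simp; linarith
  have hfin : Finite (Vertex P) := hP.finite_extremePoints
  obtain ⟨M, hM⟩ : ∃ M : ℝ, ∀ y : Vertex P, l y = l u ∨ g y - g u < M * (l u - l y) := by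
    have : ∀ y : Vertex P, ∀ᶠ M : ℝ in Filter.atTop,
        l y = l u ∨ g y - g u < M * (l u - l y) := by
      intro y
      rcases (hl.le y y.2.1).eq_or_lt with h | h
      · exact Filter.Eventually.of_forall fun _ => Or.inl h
      · filter_upwards [Filter.eventually_gt_atTop ((g y - g u) / (l u - l y))] with M hM
        right
        rwa [div_lt_iff₀ (by linarith)] at hM
    exact (Filter.eventually_all.2 this).exists
  set L : E3 →L[ℝ] ℝ := M • l + g with hL
  have hLy : ∀ y : Vertex P, L y ≤ L u ∧ (L y = L u → y = u ∨ y = v) := by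
    intro y
    have e : L y - L u = (g y - g u) - M * (l u - l y) := by simp [hL]; ring
    rcases hM y with h | h
    · rw [h, sub_self, mul_zero] at e
      rcases hl.eq_of_apply_eq hP.convex h with rfl | rfl | rfl
      · exact ⟨le_rfl, fun _ => Or.inl rfl⟩
      · exact ⟨by linarith, fun _ => Or.inr rfl⟩
      · exact ⟨by linarith, fun _ => by linarith⟩
    · exact ⟨by linarith, fun _ => by linarith⟩
  have hLv : L v = L u := by simp [hL, hgv, hl.eq₁]
  have hLP : ∀ x ∈ P, L x ≤ L u := fun x hx => by
    rw [hP.eq_convexHull_extremePoints] at hx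
    exact le_of_mem_convexHull (fun y hy => (hLy ⟨y, hy⟩).1) hx
  refine ⟨L, Set.Subset.antisymm (fun x hx => ?_) fun x hx => ?_⟩
  · refine ⟨hP.convex.segment_subset u.2.1 v.2.1 hx, fun y hy => (hLP y hy).trans ?_⟩
    obtain ⟨a, b, -, -, hab, rfl⟩ := hx
    rw [map_add, map_smul, map_smul, hLv, smul_eq_mul, smul_eq_mul, ← add_mul, hab, one_mul]
  · have hx' := hx.1
    rw [hP.eq_convexHull_extremePoints] at hx'
    have := mem_convexHull_sep_of_eq (fun y hy => (hLy ⟨y, hy⟩).1) hx'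
      (le_antisymm (hLP x hx.1) (hx.2 u u.2.1))
    rw [← convexHull_pair]
    refine convexHull_mono (fun y hy => ?_) this
    rcases (hLy ⟨y, hy.1⟩).2 hy.2 with h | h
    · exact Or.inl (congrArg Subtype.val h)
    · exact Or.inr (congrArg Subtype.val h)

/-- Every vertex of a polytope is exposed. -/
theorem exists_pos_at_vertex (hP : IsConvexPolytope P) (v : Vertex P) :
    ∃ h : E3 →L[ℝ] ℝ, ∀ x ∈ P, x ≠ v → 0 < h (x - v) := by
  have hfin : (P.extremePoints ℝ \ {(v : E3)}).Finite :=
    hP.finite_extremePoints.subset Set.sdiff_subset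
  have hv : (v : E3) ∉ convexHull ℝ (P.extremePoints ℝ \ {(v : E3)}) := by
    intro hmem
    have hsub : convexHull ℝ (P.extremePoints ℝ \ {(v : E3)}) ⊆ P :=
      convexHull_min (fun y hy => hy.1.1) hP.convex
    have := extremePoints_convexHull_subset
      (inter_extremePoints_subset_extremePoints_of_subset hsub ⟨hmem, v.2⟩)
    exact this.2 rfl
  obtain ⟨f, m, hm, hf⟩ := geometric_hahn_banach_point_closed (convex_convexHull ℝ _)
    (hfin.isClosed_convexHull ℝ) hv
  have hle : ∀ y ∈ P.extremePoints ℝ, (-f) y ≤ (-f) v := fun y hy => by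
    by_cases hyv : y = v
    · rw [hyv]
    · have := hf y (subset_convexHull ℝ _ ⟨hy, hyv⟩)
      simp; linarith
  refine ⟨f, fun x hx hxv => ?_⟩
  rw [hP.eq_convexHull_extremePoints] at hx
  have h1 := le_of_mem_convexHull hle hx
  rcases h1.eq_or_lt with h2 | h2
  · refine absurd ?_ hxv
    have := mem_convexHull_sep_of_eq hle hx h2
    have hs : {s ∈ P.extremePoints ℝ | (-f) s = (-f) v} ⊆ {(v : E3)} := by
      rintro s ⟨hs, hs'⟩
      by_contra hsv
      have := hf s (subset_convexHull ℝ _ ⟨hs, hsv⟩)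
      simp at hs'
      linarith
    simpa using convexHull_mono hs this
  · rw [map_sub]
    simp at h2
    linarith

/-! ### Leaving the vertex cone through a face -/

theorem exists_ne_zero_ker_inf_ker (f g : E3 →L[ℝ] ℝ) : ∃ e : E3, e ≠ 0 ∧ f e = 0 ∧ g e = 0 := by
  have := LinearMap.ker_ne_bot_of_finrank_lt (f := f.toLinearMap.prod g.toLinearMap) (by simp)
  obtain ⟨e, he, he0⟩ := Submodule.exists_mem_ne_zero_of_ne_bot this
  have he' : (f e, g e) = 0 := he
  rw [Prod.mk_eq_zero] at he'
  exact ⟨e, he0, he'.1, he'.2⟩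

theorem exists_mem_interior_pos (hP : IsConvexPolytope P) (f : E3 →L[ℝ] ℝ) (v : E3) {p : E3}
    (hp : p ∈ P) (hfp : 0 < f (p - v)) : ∃ c, v + c ∈ interior P ∧ 0 < f c := by
  have hcl : p ∈ closure (interior P) := by
    rw [hP.convex.closure_interior_eq_closure_of_nonempty_interior hP.interior_nonempty]
    exact subset_closure hp
  obtain ⟨x, hx, hxi⟩ := mem_closure_iff.1 hcl {x | 0 < f (x - v)}
    (isOpen_lt continuous_const (by fun_prop)) hfp
  exact ⟨x - v, by simpa using hxi, hx⟩

/-- The face normals at the vertex `v` describe `P` near `v`: a direction on which the normals of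
all faces through `v` are nonpositive points into `P`. -/
theorem exists_add_smul_mem (hP : IsSimplicialPolytope P) (v : Vertex P)
    {N : Vertex P → Vertex P → Vertex P → E3 →L[ℝ] ℝ}
    (hN : ∀ a b d, IsTriangularFace P a b d → IsFaceNormal P (N a b d) a b d) {x : E3}
    (hx : ∀ a b d, IsTriangularFace P a b d → N a b d v = N a b d a → N a b d x ≤ 0) :
    ∃ s : ℝ, 0 < s ∧ (v : E3) + s • x ∈ P := by
  have hfin : Finite (Vertex P) := hP.finite_extremePoints
  have hev : ∀ a b d, ∀ᶠ s in nhdsWithin (0 : ℝ) (Set.Ioi 0),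
      IsTriangularFace P a b d → N a b d (v + s • x) ≤ N a b d a := by
    intro a b d
    by_cases hF : IsTriangularFace P a b d
    swap
    · exact Filter.Eventually.of_forall fun _ h => absurd h hF
    rcases ((hN a b d hF).le v v.2.1).lt_or_eq with hlt | heq
    · have hc : Continuous fun s : ℝ => N a b d (v + s • x) := by fun_prop
      have : Filter.Tendsto (fun s : ℝ => N a b d (v + s • x))
          (nhdsWithin 0 (Set.Ioi 0)) (nhds (N a b d v)) := by
        simpa using (hc.tendsto 0).mono_left nhdsWithin_le_nhds
      exact (this.eventually (gt_mem_nhds hlt)).mono fun _ h _ => le_of_lt h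
    · filter_upwards [self_mem_nhdsWithin] with s hs _
      have := mul_nonpos_of_nonneg_of_nonpos (le_of_lt hs) (hx a b d hF heq)
      rw [map_add, map_smul, smul_eq_mul, heq]
      linarith
  obtain ⟨s, hs, hs0⟩ := ((Filter.eventually_all.2 fun a => Filter.eventually_all.2 fun b =>
    Filter.eventually_all.2 fun d => hev a b d).and self_mem_nhdsWithin).exists
  refine ⟨s, hs0, ?_⟩
  by_contra hmem
  obtain ⟨a, b, d, hF, l, hl, hlt⟩ := exists_isTriangularFace_separating hP hmem
  have hn := hN a b d hF
  obtain ⟨κ, hκ⟩ := hl.exists_eq_smul hF (f := N a b d) (by rw [map_sub, hn.eq₁, sub_self])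
    (by rw [map_sub, hn.eq₂, sub_self])
  obtain ⟨q, hq⟩ := hP.interior_nonempty
  have h1 := lt_of_mem_interior hn.ne_zero hn.le hq
  have h2 := lt_of_mem_interior hl.ne_zero hl.le hq
  have h3 := hs a b d hF
  rw [hκ] at h1 h3
  simp only [smul_apply, smul_eq_mul] at h1 h3
  have hκ0 : 0 < κ := by
    by_contra hc
    nlinarith
  nlinarith

/-- Moving from an interior point `v + c` in a direction `e` along which `h` is constant, where `h`
exposes the vertex `v`, one leaves the cone of `P` at `v` through a triangular face. -/
theorem exists_face_exit (hP : IsSimplicialPolytope P) (v : Vertex P) {h : E3 →L[ℝ] ℝ}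
    (hh : ∀ x ∈ P, x ≠ v → 0 < h (x - v)) {c e : E3} (hc : (v : E3) + c ∈ interior P)
    (he : e ≠ 0) (hhe : h e = 0) :
    ∃ u w, IsTriangularFace P v u w ∧ ∃ l, IsFaceNormal P l v u w ∧ l c < 0 ∧ 0 < l e ∧
      ∃ t α β : ℝ, 0 < t ∧ 0 ≤ α ∧ 0 ≤ β ∧
        c + t • e = α • ((u : E3) - v) + β • ((w : E3) - v) := by
  have hfin : Finite (Vertex P) := hP.finite_extremePoints
  choose! N hN using fun a b d => fun hF : IsTriangularFace P a b d =>
    hF.exists_isFaceNormal hP.toIsConvexPolytope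
  -- the faces through `v` which bound the motion in the direction `e`
  set I : Set (Vertex P × Vertex P × Vertex P) :=
    {p | IsTriangularFace P p.1 p.2.1 p.2.2 ∧
      N p.1 p.2.1 p.2.2 v = N p.1 p.2.1 p.2.2 p.1 ∧ 0 < N p.1 p.2.1 p.2.2 e} with hI
  have hIne : I.Nonempty := by
    rw [Set.nonempty_iff_ne_empty]
    intro hemp
    obtain ⟨s, hs, hsP⟩ := exists_add_smul_mem hP v hN (x := e) fun a b d hF hv => by
      by_contra! hpos
      have : (a, b, d) ∈ I := ⟨hF, hv, hpos⟩
      rw [hemp] at this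
      exact this
    have hne : (v : E3) + s • e ≠ v := by
      rw [Ne, add_eq_left]
      exact smul_ne_zero hs.ne' he
    have := hh _ hsP hne
    rw [add_sub_cancel_left, map_smul, hhe, smul_zero] at this
    exact lt_irrefl _ this
  obtain ⟨⟨a, b, d⟩, ⟨hF, hv, hpos⟩, hmin⟩ := Set.exists_min_image I
    (fun p => -(N p.1 p.2.1 p.2.2 c) / N p.1 p.2.1 p.2.2 e) I.toFinite hIne
  dsimp only at hF hv hpos hmin
  have hcneg : ∀ a b d, IsTriangularFace P a b d → N a b d v = N a b d a → N a b d c < 0 := by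
    intro a b d hF hv
    have := lt_of_mem_interior (hN a b d hF).ne_zero (hN a b d hF).le hc
    rw [map_add] at this
    linarith
  have hn := hN a b d hF
  have hlc := hcneg a b d hF hv
  set l := N a b d with hl
  set t := -(l c) / l e with ht
  have ht0 : 0 < t := div_pos (by linarith) hpos
  obtain ⟨s, hs, hsP⟩ := exists_add_smul_mem hP v hN (x := c + t • e) fun a' b' d' hF' hv' => by
    have h1 := hcneg a' b' d' hF' hv'
    rw [map_add, map_smul, smul_eq_mul]
    by_cases h2 : 0 < N a' b' d' e
    · have := hmin (a', b', d') ⟨hF', hv', h2⟩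
      rw [le_div_iff₀ h2] at this
      linarith
    · have := mul_nonpos_of_nonneg_of_nonpos ht0.le (not_lt.1 h2)
      linarith
  have hlx : l (c + t • e) = 0 := by
    rw [map_add, map_smul, smul_eq_mul, ht, div_mul_cancel₀ _ hpos.ne']
    ring
  obtain ⟨u, w, hF', hn'⟩ : ∃ u w, IsTriangularFace P v u w ∧ IsFaceNormal P l v u w := by
    rcases hn.eq_of_apply_eq hP.convex hv with rfl | rfl | rfl
    · exact ⟨b, d, hF, hn⟩
    · exact ⟨a, d, hF.swap_left, hn.swap_left⟩
    · exact ⟨a, b, hF.swap_right.swap_left, hn.swap_right.swap_left⟩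
  obtain ⟨α, β, hα, hβ, hαβ⟩ := exists_nonneg_of_mem_convexHull (hn'.mem _ hsP (by
    rw [map_add, map_smul, hlx, smul_zero, add_zero]))
  refine ⟨u, w, hF', l, hn', hlc, hpos, t, α / s, β / s, ht0, by positivity, by positivity, ?_⟩
  rw [add_sub_cancel_left] at hαβ
  rw [← inv_smul_smul₀ hs.ne' (c + t • e), hαβ]
  rw [smul_add, smul_smul, smul_smul, div_eq_inv_mul, div_eq_inv_mul]

/-- If a functional is not maximal over `P` at `v`, it increases along some edge at `v`. -/
theorem exists_face_pos (hP : IsSimplicialPolytope P) (v : Vertex P) {f : E3 →L[ℝ] ℝ} {p : E3}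
    (hp : p ∈ P) (hfp : 0 < f (p - v)) :
    ∃ u w, IsTriangularFace P v u w ∧ 0 < f ((u : E3) - v) := by
  obtain ⟨h, hh⟩ := exists_pos_at_vertex hP.toIsConvexPolytope v
  obtain ⟨c, hc, hfc⟩ := exists_mem_interior_pos hP.toIsConvexPolytope f v hp hfp
  obtain ⟨e, he, hfe, hhe⟩ := exists_ne_zero_ker_inf_ker f h
  obtain ⟨u, w, hF, -, -, -, -, t, α, β, -, hα, hβ, heq⟩ := exists_face_exit hP v hh hc he hhe
  have := congrArg f heq
  rw [map_add, map_add, map_smul, map_smul, map_smul, hfe, smul_zero, add_zero, smul_eq_mul,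
    smul_eq_mul] at this
  by_cases hu : 0 < f ((u : E3) - v)
  · exact ⟨u, w, hF, hu⟩
  · refine ⟨w, u, hF.swap_right, ?_⟩
    by_contra hw
    have h1 := mul_nonpos_of_nonneg_of_nonpos hα (not_lt.1 hu)
    have h2 := mul_nonpos_of_nonneg_of_nonpos hβ (not_lt.1 hw)
    linarith

/-! ### Sign changes of a linear functional around a vertex -/

/-- Tilting `f` slightly by a functional exposing `v` makes it negative on the edges at `v` where it
vanished and keeps its other signs. -/
theorem exists_tilt (hP : IsConvexPolytope P) {v : Vertex P} {h : E3 →L[ℝ] ℝ}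
    (hh : ∀ x ∈ P, x ≠ v → 0 < h (x - v))
    (f : E3 →L[ℝ] ℝ) : ∃ f' : E3 →L[ℝ] ℝ, ∀ u : Vertex P, u ≠ v →
      (0 < f ((u : E3) - v) → 0 < f' ((u : E3) - v)) ∧
      (f ((u : E3) - v) ≤ 0 → f' ((u : E3) - v) < 0) := by
  have hfin : Finite (Vertex P) := hP.finite_extremePoints
  have : ∀ u : Vertex P, ∀ᶠ ε in nhdsWithin (0 : ℝ) (Set.Ioi 0),
      0 < f ((u : E3) - v) → 0 < (f - ε • h) ((u : E3) - v) := by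
    intro u
    by_cases hu : 0 < f ((u : E3) - v)
    · have hc : Continuous fun ε : ℝ => (f - ε • h) ((u : E3) - v) := by
        simp only [sub_apply, smul_apply]
        fun_prop
      have : Filter.Tendsto (fun ε : ℝ => (f - ε • h) ((u : E3) - v))
          (nhdsWithin 0 (Set.Ioi 0)) (nhds (f ((u : E3) - v))) := by
        simpa using (hc.tendsto 0).mono_left nhdsWithin_le_nhds
      exact (this.eventually (lt_mem_nhds hu)).mono fun _ h _ => h
    · exact Filter.Eventually.of_forall fun _ h => absurd h hu
  obtain ⟨ε, hε, hε0⟩ := ((Filter.eventually_all.2 this).and self_mem_nhdsWithin).exists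
  refine ⟨f - ε • h, fun u hu => ⟨hε u, fun hfu => ?_⟩⟩
  have := mul_pos hε0 (hh u u.2.1 fun h => hu (Subtype.ext h))
  rw [sub_apply, smul_apply, smul_eq_mul]
  linarith

/-- The two functionals are linearly independent, so their common zeros form a line. -/
theorem exists_direction_of_level {f h : E3 →L[ℝ] ℝ} {x y : E3} (hx : 0 < f x) (hy : f y < 0)
    (hhx : 0 < h x) (hhy : 0 < h y) :
    ∃ e : E3, ∀ z, f z = 0 → h z = 0 → ∃ τ : ℝ, z = τ • e := by
  set L := f.toLinearMap.prod h.toLinearMap with hL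
  have hdet : 0 < f x * h y - f y * h x := by nlinarith [mul_pos hx hhy, mul_pos (neg_pos.2 hy) hhx]
  have hsurj : LinearMap.range L = ⊤ := by
    rw [LinearMap.range_eq_top]
    rintro ⟨a, b⟩
    refine ⟨(f x * h y - f y * h x)⁻¹ • ((a * h y - b * f y) • x + (b * f x - a * h x) • y), ?_⟩
    have happ : ∀ z, L z = (f z, h z) := fun _ => rfl
    rw [happ, Prod.mk.injEq]
    simp only [map_smul, map_add, smul_eq_mul]
    constructor <;> rw [inv_mul_eq_iff_eq_mul₀ hdet.ne'] <;> ring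
  have hrank := L.finrank_range_add_finrank_ker
  rw [hsurj, finrank_top] at hrank
  have h1 : Module.finrank ℝ (LinearMap.ker L) = 1 := by simp at hrank; omega
  obtain ⟨e, -, he⟩ := finrank_eq_one_iff'.1 h1
  refine ⟨e, fun z hz hz' => ?_⟩
  obtain ⟨τ, hτ⟩ := he ⟨z, show (f z, h z) = 0 by rw [hz, hz']; rfl⟩
  exact ⟨τ, congrArg Subtype.val hτ.symm⟩

/-- A plane through `v`, here `v + ker f`, crosses the interior of at most two faces at `v`: it
meets each in a ray, a transversal plane cuts these rays in collinear points, and if there were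
three of them, the normal of the face of the middle point would have to vanish at another one. -/
theorem card_le_two_of_strict (hP : IsSimplicialPolytope P) {v : Vertex P} {f : E3 →L[ℝ] ℝ}
    {S : Finset (Vertex P × Vertex P)}
    (hS : ∀ p ∈ S, IsTriangularFace P v p.1 p.2 ∧ 0 < f ((p.1 : E3) - v) ∧ f ((p.2 : E3) - v) < 0) :
    S.card ≤ 2 := by
  obtain ⟨h, hh⟩ := exists_pos_at_vertex hP.toIsConvexPolytope v
  have hpos : ∀ u : Vertex P, f ((u : E3) - v) ≠ 0 → 0 < h ((u : E3) - v) := fun u hu =>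
    hh u u.2.1 fun h => hu (by rw [h, sub_self, map_zero])
  by_contra! hcard
  obtain ⟨p₁, h₁, p₂, h₂, p₃, h₃, h₁₂, h₁₃, h₂₃⟩ := Finset.two_lt_card.1 hcard
  -- the point where the plane `f = 0` meets a face, normalised to height one
  have hr : ∀ p ∈ S, ∃ α β : ℝ, 0 < α ∧ 0 < β ∧
      f (α • ((p.1 : E3) - v) + β • ((p.2 : E3) - v)) = 0 ∧
      h (α • ((p.1 : E3) - v) + β • ((p.2 : E3) - v)) = 1 := by
    intro p hp
    obtain ⟨-, hf1, hf2⟩ := hS p hp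
    have hh1 := hpos _ hf1.ne'
    have hh2 := hpos _ hf2.ne
    have hD : 0 < -f ((p.2 : E3) - v) * h ((p.1 : E3) - v) +
        f ((p.1 : E3) - v) * h ((p.2 : E3) - v) :=
      add_pos (mul_pos (neg_pos.2 hf2) hh1) (mul_pos hf1 hh2)
    refine ⟨-f ((p.2 : E3) - v) / _, f ((p.1 : E3) - v) / _, div_pos (neg_pos.2 hf2) hD,
      div_pos hf1 hD, ?_, ?_⟩
    · rw [map_add, map_smul, map_smul, smul_eq_mul, smul_eq_mul]
      ring
    · rw [map_add, map_smul, map_smul, smul_eq_mul, smul_eq_mul,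
        div_mul_eq_mul_div, div_mul_eq_mul_div, ← add_div, div_self hD.ne']
  choose! α β hα hβ hf0 hh1 using hr
  set r : Vertex P × Vertex P → E3 := fun p =>
    α p • ((p.1 : E3) - v) + β p • ((p.2 : E3) - v) with hrdef
  obtain ⟨e, he⟩ := exists_direction_of_level (hS _ h₁).2.1 (hS _ h₁).2.2
    (hpos _ (hS _ h₁).2.1.ne') (hpos _ (hS _ h₁).2.2.ne)
  have hτ : ∀ p ∈ S, ∃ τ : ℝ, r p = r p₁ + τ • e := by
    intro p hp
    obtain ⟨τ, hτ⟩ := he (r p - r p₁) ((map_sub f _ _).trans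
      (by rw [hf0 p hp, hf0 _ h₁, sub_self]))
      ((map_sub h _ _).trans (by rw [hh1 p hp, hh1 _ h₁, sub_self]))
    exact ⟨τ, by rw [← hτ]; abel⟩
  choose! τ hτ using hτ
  have hface : ∀ p ∈ S, ∀ q ∈ S, ∀ l, IsFaceNormal P l v q.1 q.2 → l (r p) = 0 → p = q := by
    intro p hp q hq l hl hlp
    obtain ⟨-, hfp1, hfp2⟩ := hS p hp
    obtain ⟨-, hfq1, hfq2⟩ := hS q hq
    have e1 := hl.le p.1 p.1.2.1
    have e2 := hl.le p.2 p.2.2.1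
    simp only [hrdef, map_add, map_smul, map_sub, smul_eq_mul] at hlp
    have hα' := hα p hp
    have hβ' := hβ p hp
    have z1 : l p.1 = l v := by nlinarith
    have z2 : l p.2 = l v := by nlinarith
    refine Prod.ext ?_ ?_
    · rcases hl.eq_of_apply_eq hP.convex z1 with h | h | h
      · simp [h] at hfp1
      · exact h
      · rw [h] at hfp1; linarith
    · rcases hl.eq_of_apply_eq hP.convex z2 with h | h | h
      · simp [h] at hfp2
      · rw [h] at hfp2; linarith
      · exact h
  -- of three points in order on the line, the middle one lies in the face of an outer one
  have key : ∀ p ∈ S, ∀ q ∈ S, ∀ s ∈ S, τ p ≤ τ q → τ q ≤ τ s → p = q ∨ s = q := by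
    intro p hp q hq s hs hpq hqs
    obtain ⟨l, hl⟩ := (hS q hq).1.exists_isFaceNormal hP.toIsConvexPolytope
    have hlr : ∀ p ∈ S, l (r p) ≤ 0 := by
      intro p hp
      have e1 := mul_nonneg (hα p hp).le (sub_nonneg.2 (hl.le p.1 p.1.2.1))
      have e2 := mul_nonneg (hβ p hp).le (sub_nonneg.2 (hl.le p.2 p.2.2.1))
      simp only [hrdef, map_add, map_smul, map_sub, smul_eq_mul]
      linarith
    have hlq : l (r q) = 0 := by
      simp only [hrdef, map_add, map_smul, map_sub, smul_eq_mul, hl.eq₁, hl.eq₂]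
      ring
    rcases hqs.lt_or_eq with hlt | heq
    · left
      refine hface p hp q hq l hl (le_antisymm (hlr p hp) ?_)
      have e1 : (τ s - τ p) • r q = (τ s - τ q) • r p + (τ q - τ p) • r s := by
        rw [hτ p hp, hτ q hq, hτ s hs]; module
      have e2 := congrArg l e1
      simp only [map_add, map_smul, smul_eq_mul, hlq, mul_zero] at e2
      have e3 := mul_nonpos_of_nonneg_of_nonpos (sub_nonneg.2 hpq) (hlr s hs)
      exact nonneg_of_mul_nonneg_right (by linarith : 0 ≤ (τ s - τ q) * l (r p)) (sub_pos.2 hlt)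
    · right
      refine hface s hs q hq l hl ?_
      rw [hτ s hs, ← heq, ← hτ q hq, hlq]
  rcases le_total (τ p₁) (τ p₂) with a | a <;> rcases le_total (τ p₂) (τ p₃) with b | b <;>
    rcases le_total (τ p₁) (τ p₃) with c | c
  · rcases key _ h₁ _ h₂ _ h₃ a b with h | h <;> simp_all
  · rcases key _ h₁ _ h₂ _ h₃ a b with h | h <;> simp_all
  · rcases key _ h₁ _ h₃ _ h₂ c b with h | h <;> simp_all
  · rcases key _ h₃ _ h₁ _ h₂ c a with h | h <;> simp_all
  · rcases key _ h₂ _ h₁ _ h₃ a c with h | h <;> simp_all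
  · rcases key _ h₂ _ h₃ _ h₁ b c with h | h <;> simp_all
  · rcases key _ h₃ _ h₂ _ h₁ b a with h | h <;> simp_all
  · rcases key _ h₃ _ h₂ _ h₁ b a with h | h <;> simp_all

open Classical in
/-- The triangular faces at `v`, as ordered pairs `(u, w)` of their other two vertices, for which
the functional `f` (measured from `v`) is positive at `u` and not positive at `w`. -/
noncomputable def signChanges [Fintype (Vertex P)] (v : Vertex P) (f : E3 →L[ℝ] ℝ) :
    Finset (Vertex P × Vertex P) :=
  {p | IsTriangularFace P v p.1 p.2 ∧ 0 < f ((p.1 : E3) - v) ∧ f ((p.2 : E3) - v) ≤ 0}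

open Classical in
/-- The triangular faces at `v`, as ordered pairs of their other two vertices, whose plane lies
in `v + ker f`. -/
noncomputable def zeroFaces [Fintype (Vertex P)] (v : Vertex P) (f : E3 →L[ℝ] ℝ) :
    Finset (Vertex P × Vertex P) :=
  {p | IsTriangularFace P v p.1 p.2 ∧ f ((p.1 : E3) - v) = 0 ∧ f ((p.2 : E3) - v) = 0}

section SignChanges

variable [Fintype (Vertex P)]

theorem mem_signChanges {v : Vertex P} {f : E3 →L[ℝ] ℝ} {p : Vertex P × Vertex P} :
    p ∈ signChanges v f ↔
      IsTriangularFace P v p.1 p.2 ∧ 0 < f ((p.1 : E3) - v) ∧ f ((p.2 : E3) - v) ≤ 0 := by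
  simp [signChanges]

theorem mem_zeroFaces {v : Vertex P} {f : E3 →L[ℝ] ℝ} {p : Vertex P × Vertex P} :
    p ∈ zeroFaces v f ↔
      IsTriangularFace P v p.1 p.2 ∧ f ((p.1 : E3) - v) = 0 ∧ f ((p.2 : E3) - v) = 0 := by
  simp [zeroFaces]

theorem card_signChanges_le (hP : IsSimplicialPolytope P) (v : Vertex P) (f : E3 →L[ℝ] ℝ) :
    (signChanges v f).card ≤ 2 := by
  obtain ⟨h, hh⟩ := exists_pos_at_vertex hP.toIsConvexPolytope v
  obtain ⟨f', hf'⟩ := exists_tilt hP.toIsConvexPolytope hh f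
  refine card_le_two_of_strict hP (v := v) (f := f') fun p hp => ?_
  obtain ⟨hF, h1, h2⟩ := mem_signChanges.1 hp
  exact ⟨hF, (hf' _ hF.swap_right.rotate.ne).1 h1, (hf' _ hF.rotate.ne).2 h2⟩

/-- A functional which is neither minimal nor maximal over `P` at `v` changes sign at least twice
around `v`: the plane where it vanishes runs through the interior of `P` and leaves the cone of `P`
at `v` on both sides. -/
theorem two_le_card_signChanges (hP : IsSimplicialPolytope P) (v : Vertex P) {f : E3 →L[ℝ] ℝ}
    {p q : E3} (hp : p ∈ P) (hfp : 0 < f (p - v)) (hq : q ∈ P) (hfq : f (q - v) < 0) :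
    2 ≤ (signChanges v f).card := by
  obtain ⟨h, hh⟩ := exists_pos_at_vertex hP.toIsConvexPolytope v
  obtain ⟨f', hf'⟩ := exists_tilt hP.toIsConvexPolytope hh f
  obtain ⟨u₀, -, -, hu₀⟩ := exists_face_pos hP v hp hfp
  obtain ⟨w₀, -, -, hw₀⟩ := exists_face_pos hP v (f := -f) hq (by simpa using hfq)
  have hu₀v : u₀ ≠ v := by rintro rfl; simp at hu₀
  have hw₀v : w₀ ≠ v := by rintro rfl; simp at hw₀
  have hu₀' := (hf' u₀ hu₀v).1 hu₀
  have hw₀' := (hf' w₀ hw₀v).2 (by rw [neg_apply] at hw₀; linarith)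
  obtain ⟨c₁, hc₁, hfc₁⟩ := exists_mem_interior_pos hP.toIsConvexPolytope f' v u₀.2.1 hu₀'
  obtain ⟨c₂, hc₂, hfc₂⟩ := exists_mem_interior_pos hP.toIsConvexPolytope (-f') v w₀.2.1
    (by rw [neg_apply]; linarith)
  rw [neg_apply] at hfc₂
  obtain ⟨c, hc, hfc⟩ : ∃ c, (v : E3) + c ∈ interior P ∧ f' c = 0 := by
    have hD : 0 < f' c₁ - f' c₂ := by linarith
    refine ⟨(-f' c₂ / (f' c₁ - f' c₂)) • c₁ + (f' c₁ / (f' c₁ - f' c₂)) • c₂, ?_, ?_⟩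
    · have hsum : -f' c₂ / (f' c₁ - f' c₂) + f' c₁ / (f' c₁ - f' c₂) = 1 := by
        field_simp; ring
      have := hP.convex.interior hc₁ hc₂ (div_nonneg hfc₂.le hD.le) (div_nonneg hfc₁.le hD.le) hsum
      convert this using 1
      generalize -f' c₂ / (f' c₁ - f' c₂) = x at hsum ⊢
      obtain rfl : x = 1 - f' c₁ / (f' c₁ - f' c₂) := by linarith
      module
    · rw [map_add, map_smul, map_smul, smul_eq_mul, smul_eq_mul]
      ring
  obtain ⟨e, he, hfe, hhe⟩ := exists_ne_zero_ker_inf_ker f' h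
  have hexit : ∀ e : E3, e ≠ 0 → f' e = 0 → h e = 0 → ∃ p ∈ signChanges v f, ∃ l : E3 →L[ℝ] ℝ,
      l ((p.1 : E3) - v) = 0 ∧ l ((p.2 : E3) - v) = 0 ∧ l c < 0 ∧ 0 < l e ∧
      ∃ t α β : ℝ, 0 < t ∧ c + t • e = α • ((p.1 : E3) - v) + β • ((p.2 : E3) - v) := by
    intro e he hfe hhe
    obtain ⟨u, w, hF, l, hl, hlc, hle, t, α, β, ht, hα, hβ, heq⟩ :=
      exists_face_exit hP v hh hc he hhe
    have hlu : l ((u : E3) - v) = 0 := by rw [map_sub, hl.eq₁, sub_self]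
    have hlw : l ((w : E3) - v) = 0 := by rw [map_sub, hl.eq₂, sub_self]
    have huv : u ≠ v := hF.swap_right.rotate.ne
    have hwv : w ≠ v := hF.rotate.ne
    have hf0 : α * f' ((u : E3) - v) + β * f' ((w : E3) - v) = 0 := by
      have := congrArg f' heq
      simp only [map_add, map_smul, smul_eq_mul, hfc, hfe, mul_zero, add_zero] at this
      linarith
    have hh0 : 0 < α * h ((u : E3) - v) + β * h ((w : E3) - v) := by
      have h1 := congrArg h heq
      have h2 := hh _ (interior_subset hc) (fun h0 => by
        rw [add_eq_left] at h0
        rw [h0, map_zero] at hlc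
        exact lt_irrefl _ hlc)
      rw [add_sub_cancel_left] at h2
      simp only [map_add, map_smul, smul_eq_mul, hhe, mul_zero, add_zero] at h1
      linarith
    have hsame : ¬ (0 < f' ((u : E3) - v) ∧ 0 < f' ((w : E3) - v)) := fun ⟨a, b⟩ => by
      have h1 : α = 0 := by nlinarith [mul_nonneg hα a.le, mul_nonneg hβ b.le]
      have h2 : β = 0 := by nlinarith [mul_nonneg hα a.le, mul_nonneg hβ b.le]
      rw [h1, h2] at hh0
      linarith
    have hsame' : ¬ (f' ((u : E3) - v) < 0 ∧ f' ((w : E3) - v) < 0) := fun ⟨a, b⟩ => by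
      have h1 : α = 0 := by
        nlinarith [mul_nonneg hα (neg_pos.2 a).le, mul_nonneg hβ (neg_pos.2 b).le]
      have h2 : β = 0 := by
        nlinarith [mul_nonneg hα (neg_pos.2 a).le, mul_nonneg hβ (neg_pos.2 b).le]
      rw [h1, h2] at hh0
      linarith
    rcases lt_or_ge 0 (f ((u : E3) - v)) with hu | hu <;>
      rcases lt_or_ge 0 (f ((w : E3) - v)) with hw | hw
    · exact absurd ⟨(hf' u huv).1 hu, (hf' w hwv).1 hw⟩ hsame
    · exact ⟨(u, w), mem_signChanges.2 ⟨hF, hu, hw⟩, l, hlu, hlw, hlc, hle, t, α, β, ht, heq⟩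
    · exact ⟨(w, u), mem_signChanges.2 ⟨hF.swap_right, hw, hu⟩, l, hlw, hlu, hlc, hle, t, β, α, ht,
        by rw [heq, add_comm]⟩
    · exact absurd ⟨(hf' u huv).2 hu, (hf' w hwv).2 hw⟩ hsame'
  obtain ⟨p₁, hp₁, l, hl1, hl2, hlc, hle, -⟩ := hexit e he hfe hhe
  obtain ⟨p₂, hp₂, -, -, -, -, -, t, α, β, ht, heq⟩ := hexit (-e) (neg_ne_zero.2 he)
    (by rw [map_neg, hfe, neg_zero]) (by rw [map_neg, hhe, neg_zero])
  refine Finset.one_lt_card.2 ⟨p₁, hp₁, p₂, hp₂, ?_⟩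
  rintro rfl
  have := congrArg l heq
  simp only [map_add, map_smul, map_neg, smul_eq_mul, hl1, hl2, mul_zero, add_zero] at this
  have := mul_pos ht hle
  linarith

/-- The total sign variation of a nonzero functional around `v`, with a penalty for a face in the
plane where it vanishes: such a face lies on a supporting plane, so that one of the two kinds of
sign change does not occur. -/
theorem card_signChanges_add_le (hP : IsSimplicialPolytope P) (v : Vertex P) {f : E3 →L[ℝ] ℝ}
    (hf : f ≠ 0) :
    (signChanges v f).card + (signChanges v (-f)).card + (zeroFaces v f).card ≤ 4 := by
  classical
  have h1 := card_signChanges_le hP v f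
  have h2 := card_signChanges_le hP v (-f)
  rcases (zeroFaces v f).eq_empty_or_nonempty with hz | ⟨p, hp⟩
  · rw [hz, Finset.card_empty]
    omega
  obtain ⟨hF, hp1, hp2⟩ := mem_zeroFaces.1 hp
  obtain ⟨l, hl⟩ := hF.exists_isFaceNormal hP.toIsConvexPolytope
  obtain ⟨κ, hκ⟩ := hl.exists_eq_smul hF hp1 hp2
  have hκ0 : κ ≠ 0 := by
    rintro rfl
    exact hf (by rw [hκ, zero_smul])
  have h3 : (zeroFaces v f).card ≤ 2 := by
    refine (Finset.card_le_card (t := {p, p.swap}) fun q hq => ?_).trans Finset.card_le_two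
    obtain ⟨hFq, hq1, hq2⟩ := mem_zeroFaces.1 hq
    have hz : ∀ x : Vertex P, x ≠ v → f ((x : E3) - v) = 0 → x = p.1 ∨ x = p.2 := by
      intro x hxv hx
      rw [hκ, smul_apply, smul_eq_mul, map_sub, mul_eq_zero, sub_eq_zero] at hx
      exact (hl.eq_of_apply_eq hP.convex (hx.resolve_left hκ0)).resolve_left hxv
    have hne := hFq.ne
    rw [Finset.mem_insert, Finset.mem_singleton]
    rcases hz _ hFq.swap_right.rotate.ne hq1 with a | a <;> rcases hz _ hFq.rotate.ne hq2 with b | b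
    · exact absurd (a.trans b.symm) hne
    · exact Or.inl (Prod.ext a b)
    · exact Or.inr (Prod.ext a b)
    · exact absurd (a.trans b.symm) hne
  have hlP : ∀ x : Vertex P, l ((x : E3) - v) ≤ 0 := fun x => by
    rw [map_sub]; linarith [hl.le x x.2.1]
  rcases hκ0.lt_or_gt with hneg | hpos
  · have : signChanges v (-f) = ∅ := by
      rw [Finset.eq_empty_iff_forall_notMem]
      intro q hq
      have h4 := (mem_signChanges.1 hq).2.1
      rw [hκ, neg_apply, smul_apply, smul_eq_mul] at h4
      nlinarith [hlP q.1]
    rw [this, Finset.card_empty]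
    omega
  · have : signChanges v f = ∅ := by
      rw [Finset.eq_empty_iff_forall_notMem]
      intro q hq
      have h4 := (mem_signChanges.1 hq).2.1
      rw [hκ, smul_apply, smul_eq_mul] at h4
      nlinarith [hlP q.1]
    rw [this, Finset.card_empty]
    omega

end SignChanges

/-! ### A point beyond the base face -/

/-- There is a point beyond the face `v₁ v₂ v₃` which is so close to the centroid of this face that
it is seen from every other vertex through the interior of `P`. -/
theorem exists_apex (hP : IsConvexPolytope P) {v₁ v₂ v₃ : Vertex P}
    (hF : IsTriangularFace P v₁ v₂ v₃) {l : E3 →L[ℝ] ℝ} (hl : IsFaceNormal P l v₁ v₂ v₃) :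
    ∃ z : E3, l v₁ < l z ∧
      ∀ v : Vertex P, l v < l v₁ → (v : E3) + (1 / 2 : ℝ) • (z - v) ∈ interior P := by
  have hfin : Finite (Vertex P) := hP.finite_extremePoints
  set p : E3 := (1 / 3 : ℝ) • ((v₁ : E3) + v₂ + v₃) with hp
  have hlp : l p = l v₁ := by
    simp only [hp, map_smul, map_add, smul_eq_mul, hl.eq₁, hl.eq₂]
    ring
  have hint : ∀ v : Vertex P, l v < l v₁ → (v : E3) + (1 / 2 : ℝ) • (p - v) ∈ interior P := by
    intro v hv
    by_contra hc
    obtain ⟨f, hf0, hf⟩ := exists_support_of_notMem_interior hP hc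
    have h0 := hf v v.2.1
    have h1 := hf v₁ v₁.2.1
    have h2 := hf v₂ v₂.2.1
    have h3 := hf v₃ v₃.2.1
    simp only [hp, map_add, map_smul, map_sub, smul_eq_mul] at h0 h1 h2 h3
    obtain ⟨κ, hκ⟩ := hl.exists_eq_smul hF (f := f) (by rw [map_sub]; linarith)
      (by rw [map_sub]; linarith)
    have h4 : f v = f v₁ := by linarith
    rw [hκ, smul_apply, smul_apply, smul_eq_mul, smul_eq_mul] at h4
    have h5 : κ * (l v₁ - l v) = 0 := by linarith
    rcases mul_eq_zero.1 h5 with h | h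
    · exact hf0 (by rw [hκ, h, zero_smul])
    · linarith
  obtain ⟨y, hy⟩ : ∃ y, 0 < l y := by
    obtain ⟨y, hy⟩ : ∃ y, l y ≠ 0 := by
      by_contra! hc
      exact hl.ne_zero (ContinuousLinearMap.ext hc)
    exact ⟨l y • y, by rw [map_smul, smul_eq_mul]; exact mul_self_pos.2 hy⟩
  have hev : ∀ v : Vertex P, ∀ᶠ δ in nhdsWithin (0 : ℝ) (Set.Ioi 0),
      l v < l v₁ → (v : E3) + (1 / 2 : ℝ) • (p + δ • y - v) ∈ interior P := by
    intro v
    by_cases hv : l v < l v₁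
    · have hc : Continuous fun δ : ℝ => (v : E3) + (1 / 2 : ℝ) • (p + δ • y - v) := by fun_prop
      have : Filter.Tendsto (fun δ : ℝ => (v : E3) + (1 / 2 : ℝ) • (p + δ • y - v))
          (nhdsWithin 0 (Set.Ioi 0)) (nhds ((v : E3) + (1 / 2 : ℝ) • (p - v))) := by
        simpa using (hc.tendsto 0).mono_left nhdsWithin_le_nhds
      exact (this.eventually (isOpen_interior.mem_nhds (hint v hv))).mono fun _ h _ => h
    · exact Filter.Eventually.of_forall fun _ h => absurd h hv
  obtain ⟨δ, hδ, hδ0⟩ := ((Filter.eventually_all.2 hev).and self_mem_nhdsWithin).exists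
  refine ⟨p + δ • y, ?_, hδ⟩
  have := mul_pos hδ0 hy
  clear_value p
  rw [map_add, map_smul, smul_eq_mul, hlp]
  linarith

/-! ### Counting sign changes -/

open Classical in
/-- Summing the jumps of the sign of `f` over the faces at `v`, each taken in both orders, counts
every sign change twice. -/
theorem sum_abs_sign_sub [Fintype (Vertex P)] (v : Vertex P) (f : E3 →L[ℝ] ℝ) :
    ∑ u : Vertex P, ∑ w : Vertex P, (if IsTriangularFace P v u w then
      |(SignType.sign (f ((u : E3) - v)) : ℤ) - SignType.sign (f ((w : E3) - v))| else 0) =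
    2 * ((signChanges v f).card + (signChanges v (-f)).card) := by
  have hcard : ∀ g : E3 →L[ℝ] ℝ, ((signChanges v g).card : ℤ) = ∑ u : Vertex P, ∑ w : Vertex P,
      if IsTriangularFace P v u w ∧ 0 < g ((u : E3) - v) ∧ g ((w : E3) - v) ≤ 0 then 1 else 0 := by
    intro g
    rw [signChanges, Finset.card_filter, Fintype.sum_prod_type]
    push_cast
    rfl
  have hcard' : ∀ g : E3 →L[ℝ] ℝ, ((signChanges v g).card : ℤ) = ∑ u : Vertex P, ∑ w : Vertex P,
      if IsTriangularFace P v u w ∧ 0 < g ((w : E3) - v) ∧ g ((u : E3) - v) ≤ 0 then 1 else 0 := by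
    intro g
    rw [hcard, Finset.sum_comm]
    simp only [isTriangularFace_swap_right (u := v)]
  have h2 : (2 * ((signChanges v f).card + (signChanges v (-f)).card) : ℤ) =
      (signChanges v f).card + (signChanges v f).card + (signChanges v (-f)).card +
        (signChanges v (-f)).card := by ring
  rw [h2]
  nth_rewrite 1 [hcard f]
  rw [hcard' f]
  nth_rewrite 1 [hcard (-f)]
  rw [hcard' (-f)]
  simp only [← Finset.sum_add_distrib]
  refine Finset.sum_congr rfl fun u _ => Finset.sum_congr rfl fun w _ => ?_
  by_cases hF : IsTriangularFace P v u w
  swap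
  · simp [hF]
  simp only [hF, if_true, true_and, neg_apply]
  have hpos : ∀ x : ℝ, 0 < x ↔ SignType.sign x = 1 := fun x => sign_eq_one_iff.symm
  simp only [← not_lt, hpos, Left.sign_neg]
  generalize SignType.sign (f ((u : E3) - v)) = s
  generalize SignType.sign (f ((w : E3) - v)) = t
  revert s t
  decide

open Classical in
theorem sum_zeroFaces [Fintype (Vertex P)] (v : Vertex P) (f : E3 →L[ℝ] ℝ) :
    ∑ u : Vertex P, ∑ w : Vertex P, (if IsTriangularFace P v u w ∧
      SignType.sign (f ((u : E3) - v)) = 0 ∧ SignType.sign (f ((w : E3) - v)) = 0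
      then (1 : ℤ) else 0) = (zeroFaces v f).card := by
  rw [zeroFaces, Finset.card_filter, Fintype.sum_prod_type]
  push_cast
  simp only [sign_eq_zero_iff]

theorem sum_rotate {V : Type*} [Fintype V] (Φ : V → V → V → ℤ) :
    ∑ u, ∑ v, ∑ w, (Φ u v w + Φ v w u + Φ w u v) = 3 * ∑ u, ∑ v, ∑ w, Φ u v w := by
  have h1 : ∑ u, ∑ v, ∑ w, Φ w u v = ∑ u, ∑ v, ∑ w, Φ u v w := by
    rw [Finset.sum_congr rfl fun u _ => Finset.sum_comm, Finset.sum_comm]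
  have h2 : ∑ u, ∑ v, ∑ w, Φ v w u = ∑ u, ∑ v, ∑ w, Φ u v w := by
    rw [Finset.sum_comm, Finset.sum_congr rfl fun u _ => Finset.sum_comm]
  simp only [Finset.sum_add_distrib, h1, h2]
  ring

/-- The flags `p`, `q`, `r` tell at which vertices of a triangle the attached vector is nonzero, and
`x`, `y`, `z` orient the edges cyclically, with `0` for an edge without orientation. Each flagged
vertex weighs the jump between its two edges, plus two if neither is oriented. An oriented triangle
has a vertex with one edge entering and one leaving, which has weight two already. -/
theorem two_le_weight_triangle : ∀ (p q r : Bool) (x y z : SignType), (p || q || r) = true →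
    (p = false → x = 0 ∧ z = 0) → (q = false → x = 0 ∧ y = 0) → (r = false → y = 0 ∧ z = 0) →
    2 ≤ (if p then |(x : ℤ) - (-z : SignType)| + 2 * (if x = 0 ∧ -z = 0 then 1 else 0) else 0) +
      (if q then |(y : ℤ) - (-x : SignType)| + 2 * (if y = 0 ∧ -x = 0 then 1 else 0) else 0) +
      (if r then |(z : ℤ) - (-y : SignType)| + 2 * (if z = 0 ∧ -y = 0 then 1 else 0) else 0) := by
  decide

/-- If the vertices of a triangle have the values `a`, `b`, `c`, only the one with the middle
value has a neighbour above and a neighbour below; so the sign jumps add up to at most two. -/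
theorem sum_sign_jumps_le_two (a b c : ℝ) :
    |(SignType.sign (b - a) : ℤ) - SignType.sign (c - a)| +
      |(SignType.sign (c - b) : ℤ) - SignType.sign (a - b)| +
      |(SignType.sign (a - c) : ℤ) - SignType.sign (b - c)| ≤ 2 := by
  have key : ∀ x y z : SignType, (x = 0 ∧ y = 0 ∧ z = 0) ∨
      ((x = 1 ∨ y = 1 ∨ z = 1) ∧ (x = -1 ∨ y = -1 ∨ z = -1)) →
      |(x : ℤ) - (-z : SignType)| + |(y : ℤ) - (-x : SignType)| +
        |(z : ℤ) - (-y : SignType)| ≤ 2 := by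
    decide
  have := key (SignType.sign (b - a)) (SignType.sign (c - b)) (SignType.sign (a - c)) (by
    simp only [sign_eq_zero_iff, sign_eq_one_iff, sign_eq_neg_one_iff]
    by_contra! h
    obtain ⟨h0, h1⟩ := h
    by_cases hpos : 0 < b - a ∨ 0 < c - b ∨ 0 < a - c
    · obtain ⟨h2, h3, h4⟩ := h1 hpos
      rcases hpos with h | h | h <;> linarith
    · push Not at hpos
      obtain ⟨h2, h3, h4⟩ := hpos
      exact h0 (by linarith) (by linarith) (by linarith))
  simp only [← Left.sign_neg, neg_sub] at this
  exact this

/-! ### Infinitesimal rigidity -/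

/-- The sign condition on an edge orients it consistently from both ends. -/
theorem _root_.HasSameSignProjections.sign_eq_neg {a : Vertex P → E3}
    (h : HasSameSignProjections P a) {u v : Vertex P} (huv : IsEdge P u v) :
    SignType.sign (innerSL ℝ (a v) ((u : E3) - v)) =
      -SignType.sign (innerSL ℝ (a u) ((v : E3) - u)) := by
  have h1 : innerSL ℝ (a v) ((u : E3) - v) = inner ℝ ((u : E3) - v) (a v) := by
    rw [innerSL_apply_apply, real_inner_comm]
  have h2 : innerSL ℝ (a u) ((v : E3) - u) = -inner ℝ ((u : E3) - v) (a u) := by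
    rw [innerSL_apply_apply, real_inner_comm, ← inner_neg_left, neg_sub]
  rw [h1, h2, Left.sign_neg, neg_neg]
  rcases h u v huv with ⟨a, b⟩ | ⟨a, b⟩ | ⟨a, b⟩
  · rw [a, b]
  · rw [sign_neg a, sign_neg b]
  · rw [sign_pos a, sign_pos b]

/-- The double count described at the top of the file: the weights `Φ`, coming from `a`, and the
jumps `Γ`, coming from a pencil of planes, are compared vertex by vertex and face by face. In the
comments a vertex `u` is live if `a u ≠ 0` and dead otherwise. -/
theorem eq_zero_of_hasSameSignProjections (hP : IsSimplicialPolytope P) {v₁ v₂ v₃ : Vertex P}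
    (hbase : IsTriangularFace P v₁ v₂ v₃) {a : Vertex P → E3} (ha : HasSameSignProjections P a)
    (hpl : IsPlanted v₁ v₂ v₃ a) (v : Vertex P) : a v = 0 := by
  classical
  by_contra hv
  have := hP.finite_extremePoints.fintype
  obtain ⟨l, hl⟩ := hbase.exists_isFaceNormal hP.toIsConvexPolytope
  have hlive : ∀ u : Vertex P, a u ≠ 0 → l u < l v₁ := fun u hu => by
    refine (hl.le u u.2.1).lt_of_ne fun h => hu ?_
    rcases hl.eq_of_apply_eq hP.convex h with rfl | rfl | rfl
    exacts [hpl.1, hpl.2.1, hpl.2.2]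
  -- a face with a live vertex `m` and a dead vertex `d`: take the live `m` nearest to the base plane
  obtain ⟨m, d, k, hface, hm, hd⟩ :
      ∃ m d k, IsTriangularFace P m d k ∧ a m ≠ 0 ∧ a d = 0 := by
    obtain ⟨m, hm, hmax⟩ := Set.exists_max_image {u : Vertex P | a u ≠ 0} (fun u => l u)
      (Set.toFinite _) ⟨v, hv⟩
    obtain ⟨d, k, hF, hpos⟩ := exists_face_pos hP m (f := l) v₁.2.1
      (by rw [map_sub]; linarith [hlive m hm])
    refine ⟨m, d, k, hF, hm, ?_⟩
    by_contra hd
    have := hmax d hd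
    rw [map_sub] at hpos
    linarith
  obtain ⟨z, hz, hzint⟩ := exists_apex hP.toIsConvexPolytope hbase hl
  -- `g` parametrizes the planes through the line on which `φ (· - z)` and `l (· - z)` vanish;
  -- `φ` is chosen so that `m` and `d` lie on the same plane, and `f u` cuts out the plane through `u`
  obtain ⟨e, he, hφm, hφd⟩ := exists_ne_zero_ker_inf_ker (innerSL ℝ ((m : E3) - z))
    (innerSL ℝ ((d : E3) - z))
  set φ : E3 →L[ℝ] ℝ := innerSL ℝ e with hφ
  have hφ0 : φ ≠ 0 := fun h => he (by
    have h1 : φ e = 0 := by rw [h]; rfl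
    simpa [hφ] using h1)
  replace hφm : φ ((m : E3) - z) = 0 := by
    rw [hφ, innerSL_apply_apply, real_inner_comm]; exact hφm
  replace hφd : φ ((d : E3) - z) = 0 := by
    rw [hφ, innerSL_apply_apply, real_inner_comm]; exact hφd
  have hB : ∀ u : Vertex P, 0 < l (z - u) := fun u => by
    rw [map_sub]; linarith [hl.le u u.2.1]
  set g : Vertex P → ℝ := fun u => φ ((u : E3) - z) / l (z - u) with hg
  set f : Vertex P → E3 →L[ℝ] ℝ := fun u => l (z - u) • φ + φ ((u : E3) - z) • l with hf
  have hfg : ∀ u w : Vertex P, SignType.sign (f u ((w : E3) - u)) = SignType.sign (g w - g u) := by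
    intro u w
    have h1 : f u ((w : E3) - u) = l (z - u) * l (z - w) * (g w - g u) := by
      have hu := (hB u).ne'
      have hw := (hB w).ne'
      simp only [hf, hg, add_apply, smul_apply, smul_eq_mul]
      field_simp
      simp only [map_sub]
      ring
    rw [h1, sign_mul, sign_pos (mul_pos (hB u) (hB w)), one_mul]
  -- the plane of the pencil through a live vertex `u` contains the interior point of `P` between
  -- `u` and `z`, so that `f u` takes both signs on `P`
  have hlower : ∀ u : Vertex P, a u ≠ 0 →
      4 ≤ (signChanges u (f u)).card + (signChanges u (-f u)).card := by
    intro u hu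
    have hint := hzint u (hlive u hu)
    have hfz : f u (z - u) = 0 := by
      simp only [hf, add_apply, smul_apply, smul_eq_mul]
      rw [← neg_sub z (u : E3), map_neg]
      ring
    have hf0 : f u ≠ 0 := by
      intro h0
      have h1 : f u ((m : E3) - z) = 0 := by rw [h0]; rfl
      simp only [hf, add_apply, smul_apply, smul_eq_mul, hφm, mul_zero, zero_add] at h1
      have h2 : l ((m : E3) - z) ≠ 0 := by
        rw [← neg_sub, map_neg]; exact neg_ne_zero.2 (hB m).ne'
      have h3 := (mul_eq_zero.1 h1).resolve_right h2
      simp only [hf, h3, zero_smul, add_zero] at h0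
      exact (smul_ne_zero (hB u).ne' hφ0) h0
    have hpos : ∀ f' : E3 →L[ℝ] ℝ, f' ≠ 0 → f' (z - u) = 0 → ∃ x ∈ P, 0 < f' (x - u) := by
      intro f' hf0 hfz
      by_contra! hc
      have := lt_of_mem_interior hf0 (m := f' u) (fun x hx => by
        have := hc x hx
        rw [map_sub] at this
        linarith) hint
      rw [map_add, map_smul, hfz, smul_zero, add_zero] at this
      exact lt_irrefl _ this
    obtain ⟨p, hp, hfp⟩ := hpos (f u) hf0 hfz
    obtain ⟨q, hq, hfq⟩ := hpos (-f u) (neg_ne_zero.2 hf0) (by rw [neg_apply, hfz, neg_zero])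
    have h1 := two_le_card_signChanges hP u hp hfp hq (by rw [neg_apply] at hfq; linarith)
    have h2 := two_le_card_signChanges hP u (f := -f u) hq hfq hp (by rw [neg_apply]; linarith)
    omega
  have hupper : ∀ u : Vertex P, a u ≠ 0 → (signChanges u (innerSL ℝ (a u))).card +
      (signChanges u (-innerSL ℝ (a u))).card + (zeroFaces u (innerSL ℝ (a u))).card ≤ 4 := by
    intro u hu
    refine card_signChanges_add_le hP u fun h => hu ?_
    have h1 : innerSL ℝ (a u) (a u) = 0 := by rw [h]; rfl
    simpa using h1
  set σ : Vertex P → Vertex P → SignType := fun u w =>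
    SignType.sign (innerSL ℝ (a u) ((w : E3) - u)) with hσ
  have hσdead : ∀ u w, a u = 0 → σ u w = 0 := fun u w hu => by simp [hσ, hu]
  set Φ : Vertex P → Vertex P → Vertex P → ℤ := fun u v w => if a u ≠ 0 then
    (if IsTriangularFace P u v w then |(σ u v : ℤ) - σ u w| else 0) +
      2 * (if IsTriangularFace P u v w ∧ σ u v = 0 ∧ σ u w = 0 then 1 else 0) else 0 with hΦ
  set Γ : Vertex P → Vertex P → Vertex P → ℤ := fun u v w => if a u ≠ 0 then
    (if IsTriangularFace P u v w then
      |(SignType.sign (g v - g u) : ℤ) - SignType.sign (g w - g u)| else 0) else 0 with hΓ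
  have hΦΓ : ∑ u, ∑ v, ∑ w, Φ u v w ≤ ∑ u, ∑ v, ∑ w, Γ u v w := by
    refine Finset.sum_le_sum fun u _ => ?_
    by_cases hu : a u = 0
    · simp [hΦ, hΓ, hu]
    have h1 : ∑ v, ∑ w, Φ u v w ≤ 8 := by
      simp only [hΦ, ne_eq, hu, not_false_eq_true, if_true, Finset.sum_add_distrib,
        ← Finset.mul_sum]
      rw [sum_abs_sign_sub, sum_zeroFaces]
      have := hupper u hu
      omega
    have h2 : 8 ≤ ∑ v, ∑ w, Γ u v w := by
      simp only [hΓ, ne_eq, hu, not_false_eq_true, if_true, ← hfg]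
      rw [sum_abs_sign_sub]
      have := hlower u hu
      omega
    exact h1.trans h2
  have hΦ2 : ∀ u v w, IsTriangularFace P u v w → (a u ≠ 0 ∨ a v ≠ 0 ∨ a w ≠ 0) →
      2 ≤ Φ u v w + Φ v w u + Φ w u v := by
    intro u v w hF hlv
    have hneg : ∀ s : SignType, -s = 0 → s = 0 := by decide
    have e1 : σ v u = -σ u v := ha.sign_eq_neg (hF.isEdge hP.toIsConvexPolytope)
    have e2 : σ w v = -σ v w := ha.sign_eq_neg (hF.rotate.isEdge hP.toIsConvexPolytope)
    have e3 : σ u w = -σ w u := ha.sign_eq_neg (hF.rotate.rotate.isEdge hP.toIsConvexPolytope)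
    have := two_le_weight_triangle (decide (a u ≠ 0)) (decide (a v ≠ 0)) (decide (a w ≠ 0))
      (σ u v) (σ v w) (σ w u) (by simpa [or_assoc] using hlv)
      (fun h => by
        have h : a u = 0 := by simpa using h
        exact ⟨hσdead _ _ h, hneg _ (e3 ▸ hσdead _ _ h)⟩)
      (fun h => by
        have h : a v = 0 := by simpa using h
        exact ⟨hneg _ (e1 ▸ hσdead _ _ h), hσdead _ _ h⟩)
      (fun h => by
        have h : a w = 0 := by simpa using h
        exact ⟨hneg _ (e2 ▸ hσdead _ _ h), hσdead _ _ h⟩)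
    simp only [decide_eq_true_eq] at this
    simp only [hΦ, hF, hF.rotate, hF.rotate.rotate, if_true, true_and, e1, e2, e3]
    exact this
  have hΓ2 : ∀ u v w, Γ u v w + Γ v w u + Γ w u v ≤ 2 := by
    intro u v w
    have hle : ∀ u v w,
        Γ u v w ≤ |(SignType.sign (g v - g u) : ℤ) - SignType.sign (g w - g u)| := by
      intro u v w
      simp only [hΓ]
      split_ifs <;> first | exact le_rfl | exact abs_nonneg _
    have := sum_sign_jumps_le_two (g u) (g v) (g w)
    linarith [hle u v w, hle v w u, hle w u v]
  have hle : ∀ u v w, Γ u v w + Γ v w u + Γ w u v ≤ Φ u v w + Φ v w u + Φ w u v := by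
    intro u v w
    by_cases hF : IsTriangularFace P u v w
    · by_cases hlv : a u ≠ 0 ∨ a v ≠ 0 ∨ a w ≠ 0
      · exact (hΓ2 u v w).trans (hΦ2 u v w hF hlv)
      · push Not at hlv
        simp [hΓ, hΦ, hlv.1, hlv.2.1, hlv.2.2]
    · have h1 : ¬ IsTriangularFace P v w u := fun h => hF h.rotate.rotate
      have h2 : ¬ IsTriangularFace P w u v := fun h => hF h.rotate
      simp [hΓ, hΦ, hF, h1, h2]
  -- the dead vertex `d` accounts for a part of the sign jumps in the face `m d k`
  have hlt : Γ m d k + Γ d k m + Γ k m d < Φ m d k + Φ d k m + Φ k m d := by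
    refine lt_of_lt_of_le ?_ (hΦ2 m d k hface (Or.inl hm))
    have hgm : g m = 0 := by simp only [hg, hφm, zero_div]
    have hgd : g d = 0 := by simp only [hg, hφd, zero_div]
    have h1 : Γ d k m = 0 := by simp [hΓ, hd]
    have h2 : Γ k m d = 0 := by simp [hΓ, hgm, hgd]
    have h3 : Γ m d k ≤ 1 := by
      simp only [hΓ, hm, hface, hgm, hgd, ne_eq, not_false_eq_true, if_true, sub_zero, sign_zero]
      generalize SignType.sign (g k) = s
      revert s
      decide
    omega
  have hsum : ∑ u, ∑ v, ∑ w, (Γ u v w + Γ v w u + Γ w u v) <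
      ∑ u, ∑ v, ∑ w, (Φ u v w + Φ v w u + Φ w u v) :=
    Finset.sum_lt_sum
      (fun u _ => Finset.sum_le_sum fun v _ => Finset.sum_le_sum fun w _ => hle u v w)
      ⟨m, Finset.mem_univ _, Finset.sum_lt_sum (fun v _ => Finset.sum_le_sum fun w _ => hle m v w)
        ⟨d, Finset.mem_univ _, Finset.sum_lt_sum (fun w _ => hle m d w)
          ⟨k, Finset.mem_univ _, hlt⟩⟩⟩
  rw [sum_rotate, sum_rotate] at hsum
  linarith

end DehnRigidity

theorem mainTheorem1 (P : Set E3) (hP : IsSimplicialPolytope P) :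
    IsInfinitesimallyRigid P ∧
      ∀ v₁ v₂ v₃ : Vertex P, IsTriangularFace P v₁ v₂ v₃ →
        ∀ a : Vertex P → E3, HasSameSignProjections P a → IsPlanted v₁ v₂ v₃ a →
          ∀ v : Vertex P, a v = 0 := by
  refine ⟨fun v₁ v₂ v₃ hF a ha hpl => ?_, fun v₁ v₂ v₃ hF a ha hpl =>
    DehnRigidity.eq_zero_of_hasSameSignProjections hP hF ha hpl⟩
  -- an infinitesimal motion has equal projections to an edge at its two ends
  refine DehnRigidity.eq_zero_of_hasSameSignProjections hP hF (fun u v huv => ?_) hpl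
  have h := ha u v huv
  rw [inner_sub_right, sub_eq_zero] at h
  rw [← h]
  rcases lt_trichotomy (inner ℝ ((u : E3) - v) (a u)) 0 with h' | h' | h'
  · exact Or.inr (Or.inl ⟨h', h'⟩)
  · exact Or.inl ⟨h', h'⟩
  · exact Or.inr (Or.inr ⟨h', h'⟩)
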